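/- Fix numbers $V$ of terms, $D$ of documents and $K\ge 1$ of topics, and $\alpha\in\mathbb{R}^K_{>0}$. Write $\Delta_{M-1}$ for the standard simplex in $\mathbb{R}^M$. Throughout, $W=(w_{vk})$ has columns $w_k\in\Delta_{V-1}$, $\beta=(\beta_{kd})$ has positive entries, and $\phi=(\phi_{vkd})$ satisfies $(\phi_{vkd})_k\in\Delta_{K-1}$ for all $v,d$. For a model with joint density $p$ of observed and latent variables, and a variational distribution $q$ of the latent variables, the variational lower bound (ELBO) is $\mathbb{E}_q[\log p]-\mathbb{E}_q[\log q]$, with value $-\infty$ if $p$ vanishes with positive $q$-probability. *Dirichlet–Poisson NMF.* Independently for each document $d$: $h_d\sim\mathrm{Dirichlet}(\alpha)$, $z_{vkd}\sim\mathrm{Poisson}(w_{vk}h_{kd})$ independently given $h_d$, and $X_{vd}=\sum_k z_{vkd}$. The variational distribution makes all $h_d$ and $z_{vd}=(z_{vkd})_k$ independent, with $h_d\sim\mathrm{Dirichlet}(\beta_d)$ and $z_{vd}\sim\mathrm{Multinomial}(x_{vd},\phi_{vd})$. Denote the ELBO by $\mathcal L^{\mathrm{DP}}(X|W,\alpha,\beta,\phi)$.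 *LDA.* A corpus consists of words $\nu_{nd}$, $1\le n\le N_d$, $1\le d\le D$; $x_{vd}$ is the number of $n$ with $\nu_{nd}=v$. Independently for each $d$: $h_d\sim\mathrm{Dirichlet}(\alpha)$, and for each $n$, $z_{nd}\sim\mathrm{Cat}(h_d)$ and $\nu_{nd}\sim\mathrm{Cat}(w_{z_{nd}})$. The variational distribution makes all $h_d$ and $z_{nd}$ independent, with $h_d\sim\mathrm{Dirichlet}(\beta_d)$ and $z_{nd}\sim\mathrm{Cat}(\phi_{\nu_{nd}d})$. Denote the ELBO (for the observed word sequences) by $\mathcal L^{\mathrm{LDA}}$. Let $\widetilde h_{kd}=\widetilde h_{kd}(\beta)=\exp(\mathbb{E}_q[\log h_{kd}])$, where $h_d\sim\mathrm{Dirichlet}(\beta_d)$ under $q$, let $\widetilde H=(\widetilde h_{kd})$, and let $$\mathcal B(X|W,\alpha,\beta,\phi)=\sum_{v,k,d}x_{vd}\phi_{vkd}\log\frac{w_{vk}\widetilde h_{kd}}{\phi_{vkd}}+\sum_d\Big(\log\Gamma(\textstyle\sum_k\alpha_k)-\log\Gamma(\sum_k\beta_{kd})\Big)+\sum_{k,d}\Big(\log\Gamma(\beta_{kd})-\log\Gamma(\alpha_k)+(\alpha_k-\beta_{kd})\mathbb{E}_q[\log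 h_{kd}]\Big),$$ where a summand of the first sum is $0$ if $x_{vd}\phi_{vkd}=0$, and $-\infty$ if $x_{vd}\phi_{vkd}>0=w_{vk}$. Then: 1. For every count matrix $X\in\mathbb{N}_0^{V\times D}$ the expectations in $\mathcal L^{\mathrm{DP}}$ exist, and $$\mathcal L^{\mathrm{DP}}(X|W,\alpha,\beta,\phi)=\mathcal B(X|W,\alpha,\beta,\phi)-D-\sum_{v,d}\log(x_{vd}!).$$ 2. For every corpus with count matrix $X$ the expectations in $\mathcal L^{\mathrm{LDA}}$ exist, and $\mathcal L^{\mathrm{LDA}}=\mathcal B(X|W,\alpha,\beta,\phi)$. Hence the two ELBOs differ only by a data-dependent constant. 3. Consider the VI procedure that, starting from $(W^{(0)},\beta^{(0)})$, takes for $n=0,1,\dots$ a maximizer $\phi^{(n)}$ of the ELBO for given $(W^{(n)},\beta^{(n)})$, and then a joint maximizer $(W^{(n+1)},\beta^{(n+1)})$ of the ELBO for given $\phi^{(n)}$. For every corpus, the sequences $(W^{(n)},\beta^{(n)},\phi^{(n)})_n$ which this procedure can produce for $\mathcal L^{\mathrm{DP}}$ (with the count matrix of the corpus) are exactly those which it can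 produce for $\mathcal L^{\mathrm{LDA}}$. 4. Every sequence of iterates of the LDA algorithm $$\phi^{(n)}_{vkd}\propto w^{(n)}_{vk}\widetilde h^{(n)}_{kd},\qquad w^{(n+1)}_{vk}\propto\sum_d x_{vd}\phi^{(n)}_{vkd},\qquad \beta^{(n+1)}_{kd}=\alpha_k+\sum_v x_{vd}\phi^{(n)}_{vkd}$$ on a count matrix $X$ is a sequence produced by the procedure in 3 for $\mathcal L^{\mathrm{DP}}$. 5. Let $X\in\mathbb{R}_{\ge0}^{V\times D}$, and suppose that $x_{vd}>0$ implies $w^{(0)}_{vk}>0$ for some $k$. Then $(W^{(n)},\beta^{(n)})_n$ is a sequence of iterates of the Dirichlet–Poisson NMF algorithm $$w^{(n+1)}_{vk}\propto w^{(n)}_{vk}\sum_d x_{vd}\frac{\widetilde h^{(n)}_{kd}}{(W^{(n)}\widetilde H^{(n)})_{vd}},\qquad \beta^{(n+1)}_{kd}=\alpha_k+\widetilde h^{(n)}_{kd}\sum_v x_{vd}\frac{w^{(n)}_{vk}}{(W^{(n)}\widetilde H^{(n)})_{vd}}$$ if and only if, for some $(\phi^{(n)})_n$, $(W^{(n)},\beta^{(n)},\phi^{(n)})_n$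 is a sequence of iterates of the LDA algorithm. Here $\phi_{vkd}$ is normalized over $k$ and $w_{vk}$ over $v$; if all the weights on the right of a $\propto$ vanish, the left side may be any point of the simplex. In 5, a summand with $x_{vd}=0$ is zero. Both algorithms start from some $W^{(0)}\in\Delta_{V-1}^K$ and $\beta^{(0)}\in\mathbb{R}_{>0}^{K\times D}$. -/

import Mathlib

open MeasureTheory

noncomputable section

namespace DirichletPoisson

/-! Index conventions: terms `v : Fin V`, documents `d : Fin D`, topics `k : Fin (m + 1)`
(so there are `K = m + 1 ≥ 1` topics). Entries are written `X v d`, `W v k`, `h k`, `β k d`,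
`φ v k d`. -/

/-! ### The distributions -/

/-- Lebesgue measure in the first `K - 1` coordinates, carried to the hyperplane `∑ k, h k = 1`. It
is the reference measure for the density of the Dirichlet distribution. -/
def simplexVolume (m : ℕ) : Measure (Fin (m + 1) → ℝ) :=
  Measure.map (fun y : Fin m → ℝ => Fin.snoc (α := fun _ => ℝ) y (1 - ∑ i, y i)) volume

open Classical in
/-- Density of the Dirichlet distribution with parameter `α`. -/
def dirichletPDF {m : ℕ} (α : Fin (m + 1) → ℝ) (h : Fin (m + 1) → ℝ) : ℝ :=
  if (∀ k, 0 < h k) ∧ ∑ k, h k = 1 then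
    Real.Gamma (∑ k, α k) / (∏ k, Real.Gamma (α k)) * ∏ k, h k ^ (α k - 1)
  else 0

/-- The Dirichlet distribution. -/
def dirichlet {m : ℕ} (α : Fin (m + 1) → ℝ) : Measure (Fin (m + 1) → ℝ) :=
  (simplexVolume m).withDensity fun h => ENNReal.ofReal (dirichletPDF α h)

/-- Probability mass function of the multinomial distribution with `x` trials and cell
probabilities `φ`. -/
def multinomialPMF {m : ℕ} (x : ℕ) (φ : Fin (m + 1) → ℝ) (z : Fin (m + 1) → ℕ) : ℝ :=
  if ∑ k, z k = x then (Nat.multinomial Finset.univ z : ℝ) * ∏ k, φ k ^ z k else 0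

/-- The multinomial distribution. -/
def multinomial {m : ℕ} (x : ℕ) (φ : Fin (m + 1) → ℝ) : Measure (Fin (m + 1) → ℕ) :=
  Measure.count.withDensity fun z => ENNReal.ofReal (multinomialPMF x φ z)

/-- The categorical distribution with probabilities `φ`. -/
def categorical {m : ℕ} (φ : Fin (m + 1) → ℝ) : Measure (Fin (m + 1)) :=
  Measure.count.withDensity fun k => ENNReal.ofReal (φ k)

/-- Probability mass function of the Poisson distribution with rate `r ≥ 0`. -/
def poissonPMF (r : ℝ) (n : ℕ) : ℝ := (ProbabilityTheory.poissonMeasure r.toNNReal).real {n}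

/-! ### Variational lower bounds -/

open Classical in
/-- `E_q[log f]`, with the value `-∞` if `f` vanishes on a set of positive `q`-measure. -/
def expLog {Ω : Type*} [MeasurableSpace Ω] (q : Measure Ω) (f : Ω → ℝ) : EReal :=
  if ∀ᵐ ω ∂q, 0 < f ω then ((∫ ω, Real.log (f ω) ∂q : ℝ) : EReal) else ⊥

/-- The variational lower bound `E_q[log p] - E_q[log q]` for a variational distribution `q` with
density `qDens`; here `p` is the joint density of the observations and the latent variables, as a
function of the latent variables. -/
def elbo {Ω : Type*} [MeasurableSpace Ω] (q : Measure Ω) (p qDens : Ω → ℝ) : EReal :=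
  expLog q p - expLog q qDens

/-- `q` is a probability measure, and the expectations in the variational lower bound exist:
`E_q[log q]` is finite, and `E_q[log p]` is finite unless `p` vanishes with positive
`q`-probability. -/
def ElboWellDefined {Ω : Type*} [MeasurableSpace Ω] (q : Measure Ω) (p qDens : Ω → ℝ) : Prop :=
  IsProbabilityMeasure q ∧ (∀ᵐ ω ∂q, 0 < qDens ω) ∧
    Integrable (fun ω => Real.log (qDens ω)) q ∧
    ((∀ᵐ ω ∂q, 0 < p ω) → Integrable (fun ω => Real.log (p ω)) q)

/-! ### The Dirichlet–Poisson model -/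

/-- The latent variables `(h_d, z_d)` of all documents, `z_d` with entries `z v k`. -/
abbrev DPLatent (V D m : ℕ) : Type :=
  Fin D → (Fin (m + 1) → ℝ) × (Fin V → Fin (m + 1) → ℕ)

/-- The joint density of the counts `X` and the latent variables:
`h_d ∼ Dirichlet(α)`, `z_{vkd} ∼ Poisson(w_{vk} h_{kd})`, `X_{vd} = ∑ k, z_{vkd}`. -/
def dpJoint {V D m : ℕ} (X : Fin V → Fin D → ℕ) (α : Fin (m + 1) → ℝ)
    (W : Fin V → Fin (m + 1) → ℝ) (ω : DPLatent V D m) : ℝ :=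
  ∏ d, ((∏ v, if ∑ k, (ω d).2 v k = X v d then (1 : ℝ) else 0) * dirichletPDF α (ω d).1 *
    ∏ v, ∏ k, poissonPMF (W v k * (ω d).1 k) ((ω d).2 v k))

/-- The mean-field distribution: independently over documents, `h_d ∼ Dirichlet(β_d)` and
`z_{vd} ∼ Multinomial(x_{vd}, φ_{vd})`, all independent. -/
def dpVar {V D m : ℕ} (X : Fin V → Fin D → ℕ) (β : Fin (m + 1) → Fin D → ℝ)
    (φ : Fin V → Fin (m + 1) → Fin D → ℝ) : Measure (DPLatent V D m) :=
  Measure.pi fun d => (dirichlet fun k => β k d).prod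
    (Measure.pi fun v => multinomial (X v d) fun k => φ v k d)

/-- The density of `dpVar`. -/
def dpVarDens {V D m : ℕ} (X : Fin V → Fin D → ℕ) (β : Fin (m + 1) → Fin D → ℝ)
    (φ : Fin V → Fin (m + 1) → Fin D → ℝ) (ω : DPLatent V D m) : ℝ :=
  ∏ d, (dirichletPDF (fun k => β k d) (ω d).1 *
    ∏ v, multinomialPMF (X v d) (fun k => φ v k d) ((ω d).2 v))

/-- The variational lower bound of the Dirichlet–Poisson model. -/
def dpElbo {V D m : ℕ} (X : Fin V → Fin D → ℕ) (α : Fin (m + 1) → ℝ)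
    (W : Fin V → Fin (m + 1) → ℝ) (β : Fin (m + 1) → Fin D → ℝ)
    (φ : Fin V → Fin (m + 1) → Fin D → ℝ) : EReal :=
  elbo (dpVar X β φ) (dpJoint X α W) (dpVarDens X β φ)

/-! ### Latent Dirichlet allocation

A corpus is given by the lengths `N d` of the documents and the words `ν d n` at the positions
`n : Fin (N d)` of document `d`. -/

/-- The term-document matrix of a corpus. -/
def wordCount {V D : ℕ} {N : Fin D → ℕ} (ν : (d : Fin D) → Fin (N d) → Fin V)
    (v : Fin V) (d : Fin D) : ℕ :=
  (Finset.univ.filter fun n => ν d n = v).card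

/-- The latent variables of LDA: topic proportions `h_d` and one topic per word. -/
abbrev LDALatent {D : ℕ} (N : Fin D → ℕ) (m : ℕ) : Type :=
  (d : Fin D) → (Fin (m + 1) → ℝ) × (Fin (N d) → Fin (m + 1))

/-- The joint density of the words and the latent variables: `h_d ∼ Dirichlet(α)`; for each
position `n`, `z_{nd} ∼ Cat(h_d)` and `ν_{nd} ∼ Cat(w_{z_{nd}})`. -/
def ldaJoint {V D m : ℕ} {N : Fin D → ℕ} (ν : (d : Fin D) → Fin (N d) → Fin V)
    (α : Fin (m + 1) → ℝ) (W : Fin V → Fin (m + 1) → ℝ) (ω : LDALatent N m) : ℝ :=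
  ∏ d, (dirichletPDF α (ω d).1 * ∏ n, ((ω d).1 ((ω d).2 n) * W (ν d n) ((ω d).2 n)))

/-- The mean-field distribution: `h_d ∼ Dirichlet(β_d)` and `z_{nd} ∼ Cat(φ_{vd})` where `v` is
the word at position `n`, all independent. -/
def ldaVar {V D m : ℕ} {N : Fin D → ℕ} (ν : (d : Fin D) → Fin (N d) → Fin V)
    (β : Fin (m + 1) → Fin D → ℝ) (φ : Fin V → Fin (m + 1) → Fin D → ℝ) :
    Measure (LDALatent N m) :=
  Measure.pi fun d => (dirichlet fun k => β k d).prod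
    (Measure.pi fun n => categorical fun k => φ (ν d n) k d)

/-- The density of `ldaVar`. -/
def ldaVarDens {V D m : ℕ} {N : Fin D → ℕ} (ν : (d : Fin D) → Fin (N d) → Fin V)
    (β : Fin (m + 1) → Fin D → ℝ) (φ : Fin V → Fin (m + 1) → Fin D → ℝ)
    (ω : LDALatent N m) : ℝ :=
  ∏ d, (dirichletPDF (fun k => β k d) (ω d).1 * ∏ n, φ (ν d n) ((ω d).2 n) d)

/-- The variational lower bound of LDA. -/
def ldaElbo {V D m : ℕ} {N : Fin D → ℕ} (ν : (d : Fin D) → Fin (N d) → Fin V)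
    (α : Fin (m + 1) → ℝ) (W : Fin V → Fin (m + 1) → ℝ) (β : Fin (m + 1) → Fin D → ℝ)
    (φ : Fin V → Fin (m + 1) → Fin D → ℝ) : EReal :=
  elbo (ldaVar ν β φ) (ldaJoint ν α W) (ldaVarDens ν β φ)

/-- `E_q[log h_{kd}]` for `h_d ∼ Dirichlet(β_d)`. -/
def meanLog {D m : ℕ} (β : Fin (m + 1) → Fin D → ℝ) (k : Fin (m + 1)) (d : Fin D) : ℝ :=
  ∫ h, Real.log (h k) ∂(dirichlet fun k' => β k' d)

/-- `h̃_{kd} = exp E_q[log h_{kd}]`. -/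
def hTilde {D m : ℕ} (β : Fin (m + 1) → Fin D → ℝ) (k : Fin (m + 1)) (d : Fin D) : ℝ :=
  Real.exp (meanLog β k d)

/-- The explicit LDA lower bound
`∑ x φ log (w h̃ / φ) + ∑_d (log Γ(∑ α) - log Γ(∑ β_d))
  + ∑_{k,d} (log Γ(β_{kd}) - log Γ(α_k) + (α_k - β_{kd}) E_q[log h_{kd}])`.
The logarithm in the first sum is extended by `log 0 = -∞`, with `0 * (-∞) = 0`; a summand with
`φ_{vkd} = 0` is zero. -/
def ldaBound {V D m : ℕ} (X : Fin V → Fin D → ℕ) (α : Fin (m + 1) → ℝ)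
    (W : Fin V → Fin (m + 1) → ℝ) (β : Fin (m + 1) → Fin D → ℝ)
    (φ : Fin V → Fin (m + 1) → Fin D → ℝ) : EReal :=
  (∑ v, ∑ k, ∑ d, (((X v d : ℝ) * φ v k d : ℝ) : EReal) *
      ENNReal.log (ENNReal.ofReal (W v k * hTilde β k d / φ v k d))) +
    (((∑ d, (Real.log (Real.Gamma (∑ k, α k)) - Real.log (Real.Gamma (∑ k, β k d)))) +
      ∑ k, ∑ d, (Real.log (Real.Gamma (β k d)) - Real.log (Real.Gamma (α k)) +
        (α k - β k d) * meanLog β k d) : ℝ) : EReal)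

/-! ### Parameter domains and algorithms -/

/-- The columns of `W` lie in the simplex of dimension `V - 1`. -/
def IsTopicMatrix {V m : ℕ} (W : Fin V → Fin (m + 1) → ℝ) : Prop :=
  ∀ k, (fun v => W v k) ∈ stdSimplex ℝ (Fin V)

/-- All entries of `β` are positive. -/
def IsDirichletParam {D m : ℕ} (β : Fin (m + 1) → Fin D → ℝ) : Prop :=
  ∀ k d, 0 < β k d

/-- Each `φ_{vd}` lies in the simplex of dimension `K - 1`. -/
def IsAssignment {V D m : ℕ} (φ : Fin V → Fin (m + 1) → Fin D → ℝ) : Prop :=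
  ∀ v d, (fun k => φ v k d) ∈ stdSimplex ℝ (Fin (m + 1))

/-- `u ∝ c`: the probability vector `u` is the normalization of the nonnegative weights `c`. If
all weights vanish, `u` may be any probability vector. -/
def PropTo {ι : Type*} [Fintype ι] (u c : ι → ℝ) : Prop :=
  u ∈ stdSimplex ℝ ι ∧ ∀ i, u i * ∑ j, c j = c i

/-- The VI (variational EM) procedure for an objective `L W β φ`: starting from `(W 0, β 0)`, in
the `n`-th iteration `φ n` maximizes `L (W n) (β n)`, and then `(W (n+1), β (n+1))` jointly
maximizes `L` for this `φ n`. -/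
def IsVIRun {V D m : ℕ}
    (L : (Fin V → Fin (m + 1) → ℝ) → (Fin (m + 1) → Fin D → ℝ) →
      (Fin V → Fin (m + 1) → Fin D → ℝ) → EReal)
    (W : ℕ → Fin V → Fin (m + 1) → ℝ) (β : ℕ → Fin (m + 1) → Fin D → ℝ)
    (φ : ℕ → Fin V → Fin (m + 1) → Fin D → ℝ) : Prop :=
  (∀ n, IsTopicMatrix (W n) ∧ IsDirichletParam (β n) ∧ IsAssignment (φ n)) ∧
  ∀ n, IsMaxOn (fun φ' => L (W n) (β n) φ') {φ' | IsAssignment φ'} (φ n) ∧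
    IsMaxOn (fun θ : (Fin V → Fin (m + 1) → ℝ) × (Fin (m + 1) → Fin D → ℝ) => L θ.1 θ.2 (φ n))
      {θ | IsTopicMatrix θ.1 ∧ IsDirichletParam θ.2} (W (n + 1), β (n + 1))

/-- The iterates of the VI algorithm of LDA: `φ_{vkd} ∝ w_{vk} h̃_{kd}` (normalized over `k`),
`w_{vk} ∝ ∑ d, x_{vd} φ_{vkd}` (normalized over `v`), `β_{kd} = α_k + ∑ v, x_{vd} φ_{vkd}`. -/
def IsLDARun {V D m : ℕ} (X : Fin V → Fin D → ℝ) (α : Fin (m + 1) → ℝ)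
    (W : ℕ → Fin V → Fin (m + 1) → ℝ) (β : ℕ → Fin (m + 1) → Fin D → ℝ)
    (φ : ℕ → Fin V → Fin (m + 1) → Fin D → ℝ) : Prop :=
  IsTopicMatrix (W 0) ∧ IsDirichletParam (β 0) ∧
  ∀ n,
    (∀ v d, PropTo (fun k => φ n v k d) fun k => W n v k * hTilde (β n) k d) ∧
    (∀ k, PropTo (fun v => W (n + 1) v k) fun v => ∑ d, X v d * φ n v k d) ∧
    ∀ k d, β (n + 1) k d = α k + ∑ v, X v d * φ n v k d

/-- The entry `(v, d)` of the matrix product of `W` and `h̃`. -/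
def recon {V D m : ℕ} (W : Fin V → Fin (m + 1) → ℝ) (β : Fin (m + 1) → Fin D → ℝ)
    (v : Fin V) (d : Fin D) : ℝ :=
  ∑ k, W v k * hTilde β k d

/-- The iterates of the VI algorithm of Dirichlet–Poisson NMF in multiplicative form:
`w_{vk} ∝ w_{vk} ∑ d, x_{vd} h̃_{kd} / (W H̃)_{vd}` (normalized over `v`) and
`β_{kd} = α_k + h̃_{kd} ∑ v, x_{vd} w_{vk} / (W H̃)_{vd}`, both updated jointly. -/
def IsDPRun {V D m : ℕ} (X : Fin V → Fin D → ℝ) (α : Fin (m + 1) → ℝ)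
    (W : ℕ → Fin V → Fin (m + 1) → ℝ) (β : ℕ → Fin (m + 1) → Fin D → ℝ) : Prop :=
  IsTopicMatrix (W 0) ∧ IsDirichletParam (β 0) ∧
  ∀ n,
    (∀ k, PropTo (fun v => W (n + 1) v k) fun v =>
      W n v k * ∑ d, X v d * (hTilde (β n) k d / recon (W n) (β n) v d)) ∧
    ∀ k d, β (n + 1) k d =
      α k + hTilde (β n) k d * ∑ v, X v d * (W n v k / recon (W n) (β n) v d)

end DirichletPoisson

end

namespace DirichletPoisson

/-! Under the variational distribution, topic proportions and allocations are independent. In both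
models the log densities of a document (`docLog`) consist of a Dirichlet term, a part linear in the
allocation counts, products of counts with `log h_k` (in the joint density only), and a term `g`
common to both densities, which cancels. Only expected counts and `E_q[log h_k]` enter the
difference. The expected counts are `x_vd φ_vkd` for the multinomial, and sum to the same over the
positions of a word in LDA, so both lower bounds lead to `finiteBound`. The Poisson model adds the
exponent `-∑ w h`, which is `-1` per document because `h` and the columns of `W` sum to one, and the
`log x!` of the multinomial density. If `w_vk = 0` while `x_vd φ_vkd > 0`, both lower bounds and the
explicit bound are `⊥`; hence the case distinction on `IsSupported` (`dpElbo_eq`, `ldaElbo_eq`).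

A real additive constant does not move maximizers, so the procedures coincide. That the LDA updates
are maximizers is Gibbs' inequality three times. For fixed `(W, β)`, each pair `(v, d)` contributes
`x_vd` times a constant minus a Kullback-Leibler divergence from `φ_vd` to the normalized weights.
For fixed `φ` the bound splits: the `W` part is a cross entropy per topic, and by conjugacy the `β`
part is minus a divergence to a Dirichlet distribution with updated parameter.

Eliminating `φ` gives the multiplicative algorithm: only the products `x_vd φ_vkd` enter the other
updates, and these are determined as long as every occurring term has positive weight in some topic,
a property that the updates preserve. -/

/-! ### Dirichlet's integral over a simplex -/

theorem lintegral_betaKernel {a b t : ℝ} (ha : 0 < a) (hb : 0 < b) (ht : 0 < t) :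
    ∫⁻ x : ℝ, ENNReal.ofReal (if 0 < x ∧ x < t then x ^ (a - 1) * (t - x) ^ (b - 1) else 0) =
      ENNReal.ofReal (Real.Gamma a * Real.Gamma b / Real.Gamma (a + b) * t ^ (a + b - 1)) := by
  have hB := ProbabilityTheory.beta_pos ha hb
  -- Substitution `x = t u`, which reduces the integral to the normalization of the beta density on
  -- the unit interval.
  rw [← Real.smul_map_volume_mul_left ht.ne', lintegral_smul_measure, abs_of_pos ht]
  rw [lintegral_map' (Measurable.aemeasurable ?_) (by fun_prop)]
  swap
  · exact (Measurable.ite ((measurableSet_Ioi (a := (0 : ℝ))).inter measurableSet_Iio)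
      (by fun_prop) (by fun_prop)).ennreal_ofReal
  have key : ∀ u : ℝ, ENNReal.ofReal (if 0 < t * u ∧ t * u < t then
      (t * u) ^ (a - 1) * (t - t * u) ^ (b - 1) else 0) =
      ENNReal.ofReal (ProbabilityTheory.beta a b * t ^ (a + b - 2)) *
        ProbabilityTheory.betaPDF a b u := by
    intro u
    rw [ProbabilityTheory.betaPDF_eq, ← ENNReal.ofReal_mul (by positivity)]
    congr 1
    have h1 : (0 < t * u ∧ t * u < t) ↔ (0 < u ∧ u < 1) := by
      rw [mul_pos_iff_of_pos_left ht]
      exact and_congr_right fun _ => by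
        constructor
        · intro h; nlinarith
        · intro h; nlinarith
    simp only [h1]
    split_ifs with h
    · have h2 : t - t * u = t * (1 - u) := by ring
      rw [h2, Real.mul_rpow ht.le h.1.le, Real.mul_rpow ht.le (by linarith),
        show a + b - 2 = (a - 1) + (b - 1) by ring, Real.rpow_add ht]
      field_simp
    · simp
  simp_rw [key]
  rw [lintegral_const_mul _ (f := ProbabilityTheory.betaPDF a b)
      (ProbabilityTheory.measurable_betaPDFReal a b).ennreal_ofReal,
    ProbabilityTheory.lintegral_betaPDF_eq_one ha hb, mul_one, smul_eq_mul,
    ← ENNReal.ofReal_mul ht.le]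
  congr 1
  rw [show a + b - 1 = (a + b - 2) + 1 by ring, Real.rpow_add ht, Real.rpow_one,
    ProbabilityTheory.beta]
  ring

open Classical in
/-- The product `∏ k, h k ^ (α k - 1)` on the open orthant. -/
noncomputable def orthantKernel {n : ℕ} (α h : Fin n → ℝ) : ℝ :=
  if ∀ k, 0 < h k then ∏ k, h k ^ (α k - 1) else 0

theorem orthantKernel_nonneg {n : ℕ} (α h : Fin n → ℝ) : 0 ≤ orthantKernel α h := by
  unfold orthantKernel
  split_ifs with hh
  · exact Finset.prod_nonneg fun k _ => Real.rpow_nonneg (hh k).le _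
  · exact le_rfl

theorem measurable_orthantKernel {n : ℕ} (α : Fin n → ℝ) :
    Measurable (orthantKernel α) := by
  classical
  refine Measurable.ite ?_ (by fun_prop) (by fun_prop)
  have : {a : Fin n → ℝ | ∀ k, 0 < a k} = ⋂ k, (fun a : Fin n → ℝ => a k) ⁻¹' Set.Ioi 0 := by
    ext; simp
  rw [this]
  exact MeasurableSet.iInter fun k => (measurable_pi_apply k) measurableSet_Ioi

/-- The kernel factors because, unlike `dirichletPDF`, it carries no constraint on the sum of the
coordinates. The induction for Dirichlet's integral peels off coordinates this way. -/
theorem orthantKernel_cons {n : ℕ} (α : Fin (n + 1) → ℝ) (x : ℝ) (h : Fin n → ℝ) :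
    orthantKernel α (Fin.cons x h : Fin (n + 1) → ℝ) =
      (if 0 < x then x ^ (α 0 - 1) else 0) * orthantKernel (fun i => α i.succ) h := by
  classical
  unfold orthantKernel
  simp only [Fin.forall_fin_succ, Fin.cons_zero, Fin.cons_succ, Fin.prod_univ_succ]
  by_cases h1 : 0 < x <;> by_cases h2 : ∀ i, 0 < h i <;> simp [h1, h2]

theorem measurable_snoc_sub_sum (m : ℕ) (t : ℝ) :
    Measurable fun y : Fin m → ℝ =>
      (Fin.snoc (α := fun _ => ℝ) y (t - ∑ i, y i) : Fin (m + 1) → ℝ) := by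
  refine measurable_pi_iff.2 fun k => ?_
  refine Fin.lastCases ?_ (fun i => ?_) k
  · simp only [Fin.snoc_last]; fun_prop
  · simp only [Fin.snoc_castSucc]; fun_prop

theorem orthantKernel_snoc_eq_zero {m : ℕ} (α : Fin (m + 1) → ℝ) {t : ℝ} (ht : t ≤ 0)
    (y : Fin m → ℝ) :
    orthantKernel α (Fin.snoc (α := fun _ => ℝ) y (t - ∑ i, y i)) = 0 := by
  unfold orthantKernel
  refine if_neg fun h => ?_
  have h1 := h (Fin.last m)
  have h2 : ∀ i, 0 < y i := fun i => by simpa using h i.castSucc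
  have h3 : 0 ≤ ∑ i, y i := Finset.sum_nonneg fun i _ => (h2 i).le
  simp only [Fin.snoc_last] at h1
  linarith

/-- **Dirichlet's integral** over a simplex of size `t`. -/
theorem lintegral_orthantKernel_snoc (m : ℕ) : ∀ (α : Fin (m + 1) → ℝ), (∀ k, 0 < α k) →
    ∀ t : ℝ, 0 < t →
    ∫⁻ y : Fin m → ℝ, ENNReal.ofReal
        (orthantKernel α (Fin.snoc (α := fun _ => ℝ) y (t - ∑ i, y i))) =
      ENNReal.ofReal ((∏ k, Real.Gamma (α k)) / Real.Gamma (∑ k, α k) *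
        t ^ (∑ k, α k - 1)) := by
  induction m with
  | zero =>
    intro α hα t ht
    have h0 := (Real.Gamma_pos_of_pos (hα 0)).ne'
    have hsn : ∀ y : Fin 0 → ℝ,
        (Fin.snoc (α := fun _ => ℝ) y (t - ∑ i, y i) : Fin (0 + 1) → ℝ) = fun _ => t := by
      intro y
      funext k
      rw [(inferInstance : Subsingleton (Fin 1)).elim k (Fin.last 0), Fin.snoc_last]
      simp
    simp_rw [hsn]
    simp [orthantKernel, ht, h0, volume_pi]
  | succ m ih =>
    intro α hα t ht
    have hS : 0 < ∑ i : Fin (m + 1), α i.succ :=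
      Finset.sum_pos (fun i _ => hα _) Finset.univ_nonempty
    set S := ∑ i : Fin (m + 1), α i.succ with hSdef
    have hG : 0 < ∏ i : Fin (m + 1), Real.Gamma (α i.succ) :=
      Finset.prod_pos fun i _ => Real.Gamma_pos_of_pos (hα _)
    set C := (∏ i : Fin (m + 1), Real.Gamma (α i.succ)) / Real.Gamma S with hC
    have hCpos : 0 < C := div_pos hG (Real.Gamma_pos_of_pos hS)
    -- The first coordinate `x` is integrated last. For fixed `x` the other coordinates fill a
    -- simplex of size `t - x`, which is why the size is a variable of the induction; what remains
    -- in `x` is a beta kernel.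
    let e := (MeasurableEquiv.piFinSuccAbove (fun _ : Fin (m + 1) => ℝ) 0).symm
    have he : MeasurePreserving e (volume.prod volume) volume :=
      (volume_preserving_piFinSuccAbove (fun _ : Fin (m + 1) => ℝ) 0).symm
    have hmeas : Measurable fun y : Fin (m + 1) → ℝ => ENNReal.ofReal
        (orthantKernel α (Fin.snoc (α := fun _ => ℝ) y (t - ∑ i, y i))) :=
      ((measurable_orthantKernel α).comp (measurable_snoc_sub_sum _ t)).ennreal_ofReal
    rw [← he.lintegral_comp hmeas, lintegral_prod (fun z => ENNReal.ofReal
      (orthantKernel α (Fin.snoc (α := fun _ => ℝ) (e z) (t - ∑ i, e z i))))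
      (hmeas.comp e.measurable).aemeasurable]
    have key : ∀ (x : ℝ) (y : Fin m → ℝ),
        orthantKernel α (Fin.snoc (α := fun _ => ℝ) (e (x, y)) (t - ∑ i, e (x, y) i)) =
        (if 0 < x then x ^ (α 0 - 1) else 0) * orthantKernel (fun i => α i.succ)
          (Fin.snoc (α := fun _ => ℝ) y ((t - x) - ∑ i, y i)) := by
      intro x y
      have h1 : e (x, y) = (Fin.cons x y : Fin (m + 1) → ℝ) := by
        simp [e, MeasurableEquiv.piFinSuccAbove, Fin.insertNthEquiv]
      rw [h1, ← orthantKernel_cons, ← Fin.cons_snoc_eq_snoc_cons, Fin.sum_univ_succ]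
      simp only [Fin.cons_zero, Fin.cons_succ, sub_sub]
    have inner : ∀ x : ℝ, ∫⁻ y : Fin m → ℝ, ENNReal.ofReal
        (orthantKernel α (Fin.snoc (α := fun _ => ℝ) (e (x, y)) (t - ∑ i, e (x, y) i))) =
        ENNReal.ofReal C * ENNReal.ofReal
          (if 0 < x ∧ x < t then x ^ (α 0 - 1) * (t - x) ^ (S - 1) else 0) := by
      intro x
      simp_rw [key]
      have hp : 0 ≤ (if 0 < x then x ^ (α 0 - 1) else 0) := by
        split_ifs with h
        · exact Real.rpow_nonneg h.le _
        · exact le_rfl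
      simp_rw [ENNReal.ofReal_mul hp]
      rw [lintegral_const_mul' _ _ ENNReal.ofReal_ne_top]
      by_cases hx : x < t
      · rw [ih _ (fun i => hα _) _ (sub_pos.2 hx), ← ENNReal.ofReal_mul hp,
          ← ENNReal.ofReal_mul hCpos.le]
        congr 1
        by_cases h0 : 0 < x
        · simp only [h0, hx, if_true, and_self]; ring
        · simp [h0]
      · simp [orthantKernel_snoc_eq_zero _ (sub_nonpos.2 (not_lt.1 hx)), hx]
    simp_rw [inner]
    rw [lintegral_const_mul', lintegral_betaKernel (hα 0) hS ht, ← ENNReal.ofReal_mul hCpos.le]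
    · congr 1
      rw [Fin.sum_univ_succ, Fin.prod_univ_succ, ← hSdef, hC]
      have := (Real.Gamma_pos_of_pos hS).ne'
      field_simp
    · exact ENNReal.ofReal_ne_top

theorem lintegral_simplexVolume_orthantKernel {m : ℕ} (α : Fin (m + 1) → ℝ)
    (hα : ∀ k, 0 < α k) :
    ∫⁻ h, ENNReal.ofReal (orthantKernel α h) ∂(simplexVolume m) =
      ENNReal.ofReal ((∏ k, Real.Gamma (α k)) / Real.Gamma (∑ k, α k)) := by
  rw [simplexVolume, lintegral_map (measurable_orthantKernel α).ennreal_ofReal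
    (measurable_snoc_sub_sum m 1), lintegral_orthantKernel_snoc m α hα 1 one_pos]
  simp

/-! ### The Dirichlet distribution: total mass, logarithmic moments, Gibbs' inequality -/

theorem ae_simplexVolume_sum_eq_one (m : ℕ) : ∀ᵐ h ∂(simplexVolume m), ∑ k, h k = 1 := by
  rw [simplexVolume, ae_map_iff (measurable_snoc_sub_sum m 1).aemeasurable
    (measurableSet_eq_fun (by fun_prop) (by fun_prop))]
  exact Filter.Eventually.of_forall fun y => by simp [Fin.sum_univ_castSucc]

theorem dirichletPDF_of_mem {m : ℕ} (α : Fin (m + 1) → ℝ) {h : Fin (m + 1) → ℝ}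
    (hh : ∑ k, h k = 1) :
    dirichletPDF α h =
      Real.Gamma (∑ k, α k) / (∏ k, Real.Gamma (α k)) * orthantKernel α h := by
  classical
  unfold dirichletPDF orthantKernel
  by_cases hp : ∀ k, 0 < h k <;> simp [hp, hh]

theorem measurable_dirichletPDF {m : ℕ} (α : Fin (m + 1) → ℝ) :
    Measurable (dirichletPDF α) := by
  classical
  refine Measurable.ite ?_ (by fun_prop) (by fun_prop)
  have : {a : Fin (m + 1) → ℝ | (∀ k, 0 < a k) ∧ ∑ k, a k = 1} =
      (⋂ k, (fun a : Fin (m + 1) → ℝ => a k) ⁻¹' Set.Ioi 0) ∩ {a | ∑ k, a k = 1} := by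
    ext; simp
  rw [this]
  exact (MeasurableSet.iInter fun k => (measurable_pi_apply k) measurableSet_Ioi).inter
    (measurableSet_eq_fun (by fun_prop) (by fun_prop))

section

variable {m : ℕ} {α β : Fin (m + 1) → ℝ}

theorem dirichletConst_pos (hα : ∀ k, 0 < α k) :
    0 < Real.Gamma (∑ k, α k) / (∏ k, Real.Gamma (α k)) :=
  div_pos (Real.Gamma_pos_of_pos (Finset.sum_pos (fun k _ => hα k) Finset.univ_nonempty))
    (Finset.prod_pos fun k _ => Real.Gamma_pos_of_pos (hα k))

theorem dirichletPDF_pos_iff (hα : ∀ k, 0 < α k) {h : Fin (m + 1) → ℝ} :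
    0 < dirichletPDF α h ↔ (∀ k, 0 < h k) ∧ ∑ k, h k = 1 := by
  classical
  unfold dirichletPDF
  split_ifs with hh
  · exact ⟨fun _ => hh, fun _ => mul_pos (dirichletConst_pos hα)
      (Finset.prod_pos fun k _ => Real.rpow_pos_of_pos (hh.1 k) _)⟩
  · simp [hh]

theorem lintegral_dirichletPDF (hα : ∀ k, 0 < α k) :
    ∫⁻ h, ENNReal.ofReal (dirichletPDF α h) ∂(simplexVolume m) = 1 := by
  have hc := dirichletConst_pos hα
  have h1 : ∀ᵐ h ∂(simplexVolume m), ENNReal.ofReal (dirichletPDF α h) =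
      ENNReal.ofReal (Real.Gamma (∑ k, α k) / (∏ k, Real.Gamma (α k))) *
        ENNReal.ofReal (orthantKernel α h) := by
    filter_upwards [ae_simplexVolume_sum_eq_one m] with h hh
    rw [dirichletPDF_of_mem α hh, ENNReal.ofReal_mul hc.le]
  rw [lintegral_congr_ae h1, lintegral_const_mul' _ _ ENNReal.ofReal_ne_top,
    lintegral_simplexVolume_orthantKernel α hα, ← ENNReal.ofReal_mul hc.le, div_mul_div_cancel₀,
    div_self, ENNReal.ofReal_one]
  · exact (Real.Gamma_pos_of_pos (Finset.sum_pos (fun k _ => hα k) Finset.univ_nonempty)).ne'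
  · exact (Finset.prod_pos fun k _ => Real.Gamma_pos_of_pos (hα k)).ne'

theorem isProbabilityMeasure_dirichlet (hα : ∀ k, 0 < α k) :
    IsProbabilityMeasure (dirichlet α) :=
  ⟨by rw [dirichlet, withDensity_apply _ MeasurableSet.univ, Measure.restrict_univ,
    lintegral_dirichletPDF hα]⟩

theorem ae_dirichlet_mem (hα : ∀ k, 0 < α k) :
    ∀ᵐ h ∂(dirichlet α), (∀ k, 0 < h k) ∧ ∑ k, h k = 1 := by
  rw [dirichlet, ae_withDensity_iff (measurable_dirichletPDF α).ennreal_ofReal]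
  refine Filter.Eventually.of_forall fun h hh => ?_
  rw [← dirichletPDF_pos_iff hα]
  by_contra hn
  exact hh (ENNReal.ofReal_of_nonpos (not_lt.1 hn))

theorem lintegral_dirichlet (f : (Fin (m + 1) → ℝ) → ENNReal) (hf : Measurable f) :
    ∫⁻ h, f h ∂(dirichlet α) =
      ∫⁻ h, ENNReal.ofReal (dirichletPDF α h) * f h ∂(simplexVolume m) := by
  rw [dirichlet, lintegral_withDensity_eq_lintegral_mul _
    (measurable_dirichletPDF α).ennreal_ofReal hf]
  rfl

/-- Multiplying the density by this negative power only replaces the parameter `α k` by `α k / 2 >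
0`, so Dirichlet's integral still converges. The power dominates the logarithm in
`integrable_log_dirichlet`. -/
theorem integrable_rpow_neg_dirichlet (hα : ∀ k, 0 < α k) (k : Fin (m + 1)) :
    Integrable (fun h => h k ^ (-(α k / 2))) (dirichlet α) := by
  classical
  refine ⟨Measurable.aestronglyMeasurable (by fun_prop), ?_⟩
  have hnn : ∀ᵐ h ∂(dirichlet α), 0 ≤ h k ^ (-(α k / 2)) := by
    filter_upwards [ae_dirichlet_mem hα] with h hh
    exact Real.rpow_nonneg (hh.1 k).le _
  rw [hasFiniteIntegral_iff_ofReal hnn, lintegral_dirichlet _ (by fun_prop)]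
  set γ : Fin (m + 1) → ℝ := Function.update α k (α k / 2) with hγ
  have hγpos : ∀ j, 0 < γ j := by
    intro j
    by_cases hj : j = k
    · subst hj; simp [hγ, hα]
    · simp [hγ, hj, hα]
  have hc := dirichletConst_pos hα
  have h1 : ∀ᵐ h ∂(simplexVolume m),
      ENNReal.ofReal (dirichletPDF α h) * ENNReal.ofReal (h k ^ (-(α k / 2))) =
      ENNReal.ofReal (Real.Gamma (∑ k, α k) / (∏ k, Real.Gamma (α k))) *
        ENNReal.ofReal (orthantKernel γ h) := by
    filter_upwards [ae_simplexVolume_sum_eq_one m] with h hh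
    rw [dirichletPDF_of_mem α hh, ENNReal.ofReal_mul hc.le, mul_assoc,
      ← ENNReal.ofReal_mul (orthantKernel_nonneg _ _)]
    congr 2
    unfold orthantKernel
    split_ifs with hp
    · rw [← Finset.mul_prod_erase _ _ (Finset.mem_univ k),
        ← Finset.mul_prod_erase (a := k) _ (fun j => h j ^ (γ j - 1)) (Finset.mem_univ k),
        mul_right_comm, ← Real.rpow_add (hp k)]
      congr 1
      · simp only [hγ, Function.update_self]; ring_nf
      · refine Finset.prod_congr rfl fun j hj => ?_
        simp [hγ, Finset.ne_of_mem_erase hj]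
    · simp
  rw [lintegral_congr_ae h1, lintegral_const_mul' _ _ ENNReal.ofReal_ne_top,
    lintegral_simplexVolume_orthantKernel γ hγpos, ← ENNReal.ofReal_mul hc.le]
  exact ENNReal.ofReal_lt_top

theorem integrable_log_dirichlet (hα : ∀ k, 0 < α k) (k : Fin (m + 1)) :
    Integrable (fun h : Fin (m + 1) → ℝ => Real.log (h k)) (dirichlet α) := by
  refine ((integrable_rpow_neg_dirichlet hα k).div_const (α k / 2)).mono'
    (Measurable.aestronglyMeasurable (by fun_prop)) ?_
  filter_upwards [ae_dirichlet_mem hα] with h hh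
  have h1 : h k ≤ 1 := hh.2 ▸ Finset.single_le_sum (fun j _ => (hh.1 j).le) (Finset.mem_univ k)
  rw [Real.norm_of_nonpos (Real.log_nonpos (hh.1 k).le h1), ← Real.log_inv,
    Real.rpow_neg (hh.1 k).le, ← Real.inv_rpow (hh.1 k).le]
  -- `log y ≤ y ^ ε / ε` with `y = 1 / h k` and `ε = α k / 2`.
  exact Real.log_le_rpow_div (inv_nonneg.2 (hh.1 k).le) (half_pos (hα k))

theorem log_dirichletPDF (hα : ∀ k, 0 < α k) {h : Fin (m + 1) → ℝ} (hp : ∀ k, 0 < h k)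
    (hs : ∑ k, h k = 1) :
    Real.log (dirichletPDF α h) = Real.log (Real.Gamma (∑ k, α k)) -
      ∑ k, Real.log (Real.Gamma (α k)) + ∑ k, (α k - 1) * Real.log (h k) := by
  have hG := Real.Gamma_pos_of_pos (Finset.sum_pos (fun k _ => hα k) Finset.univ_nonempty)
  have hGk := fun k => (Real.Gamma_pos_of_pos (hα k))
  rw [dirichletPDF, if_pos ⟨hp, hs⟩, Real.log_mul (dirichletConst_pos hα).ne'
    (Finset.prod_pos fun k _ => Real.rpow_pos_of_pos (hp k) _).ne',
    Real.log_div hG.ne' (Finset.prod_pos fun k _ => hGk k).ne',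
    Real.log_prod fun k _ => (hGk k).ne',
    Real.log_prod fun k _ => (Real.rpow_pos_of_pos (hp k) _).ne']
  simp only [Real.log_rpow (hp _)]

theorem log_dirichletPDF_ae (hα : ∀ k, 0 < α k) (hβ : ∀ k, 0 < β k) :
    (fun h => Real.log (dirichletPDF α h)) =ᵐ[dirichlet β] fun h =>
      Real.log (Real.Gamma (∑ k, α k)) -
      ∑ k, Real.log (Real.Gamma (α k)) + ∑ k, (α k - 1) * Real.log (h k) := by
  filter_upwards [ae_dirichlet_mem hβ] with h hh
  exact log_dirichletPDF hα hh.1 hh.2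

theorem integrable_log_dirichletPDF (hα : ∀ k, 0 < α k) (hβ : ∀ k, 0 < β k) :
    Integrable (fun h => Real.log (dirichletPDF α h)) (dirichlet β) := by
  have := isProbabilityMeasure_dirichlet hβ
  refine Integrable.congr ?_ (log_dirichletPDF_ae hα hβ).symm
  exact (integrable_const _).add
    (integrable_finsetSum _ fun k _ => (integrable_log_dirichlet hβ k).const_mul _)

theorem integral_log_dirichletPDF (hα : ∀ k, 0 < α k) (hβ : ∀ k, 0 < β k) :
    ∫ h, Real.log (dirichletPDF α h) ∂(dirichlet β) =
      Real.log (Real.Gamma (∑ k, α k)) - ∑ k, Real.log (Real.Gamma (α k)) +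
        ∑ k, (α k - 1) * ∫ h, Real.log (h k) ∂(dirichlet β) := by
  have := isProbabilityMeasure_dirichlet hβ
  rw [integral_congr_ae (log_dirichletPDF_ae hα hβ), integral_add (integrable_const _)
    (integrable_finsetSum _ fun k _ => (integrable_log_dirichlet hβ k).const_mul _),
    integral_finsetSum _ fun k _ => (integrable_log_dirichlet hβ k).const_mul _]
  simp [integral_const_mul]

/-- **Gibbs' inequality** for Dirichlet distributions. -/
theorem integral_log_dirichletPDF_le (hα : ∀ k, 0 < α k) (hβ : ∀ k, 0 < β k) :
    ∫ h, Real.log (dirichletPDF α h) ∂(dirichlet β) ≤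
      ∫ h, Real.log (dirichletPDF β h) ∂(dirichlet β) := by
  have := isProbabilityMeasure_dirichlet hβ
  have hm : Measurable fun h => dirichletPDF α h / dirichletPDF β h :=
    (measurable_dirichletPDF α).div (measurable_dirichletPDF β)
  -- Both densities are positive at exactly the same points, so the quotient integrates to the full
  -- mass of the other Dirichlet distribution. Then `log y ≤ y - 1` finishes.
  have hl : ∫⁻ h, ENNReal.ofReal (dirichletPDF α h / dirichletPDF β h) ∂(dirichlet β) = 1 := by
    rw [lintegral_dirichlet _ hm.ennreal_ofReal, ← lintegral_dirichletPDF hα]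
    refine lintegral_congr fun h => ?_
    by_cases hp : 0 < dirichletPDF β h
    · rw [← ENNReal.ofReal_mul hp.le, mul_div_cancel₀ _ hp.ne']
    · have h2 : ¬ 0 < dirichletPDF α h := by
        rwa [dirichletPDF_pos_iff hα, ← dirichletPDF_pos_iff hβ]
      rw [ENNReal.ofReal_of_nonpos (not_lt.1 hp), ENNReal.ofReal_of_nonpos (not_lt.1 h2), zero_mul]
  have hnn : ∀ᵐ h ∂(dirichlet β), 0 ≤ dirichletPDF α h / dirichletPDF β h := by
    filter_upwards [ae_dirichlet_mem hβ] with h hh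
    exact (div_pos ((dirichletPDF_pos_iff hα).2 hh) ((dirichletPDF_pos_iff hβ).2 hh)).le
  have hint : Integrable (fun h => dirichletPDF α h / dirichletPDF β h) (dirichlet β) := by
    refine ⟨hm.aestronglyMeasurable, ?_⟩
    rw [hasFiniteIntegral_iff_ofReal hnn, hl]
    exact ENNReal.one_lt_top
  have h1 : ∫ h, dirichletPDF α h / dirichletPDF β h ∂(dirichlet β) = 1 := by
    rw [integral_eq_lintegral_of_nonneg_ae hnn hm.aestronglyMeasurable, hl, ENNReal.toReal_one]
  rw [← sub_nonpos, ← integral_sub (integrable_log_dirichletPDF hα hβ)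
    (integrable_log_dirichletPDF hβ hβ)]
  calc _ ≤ ∫ h, (dirichletPDF α h / dirichletPDF β h - 1) ∂(dirichlet β) := by
        refine integral_mono_ae ((integrable_log_dirichletPDF hα hβ).sub
          (integrable_log_dirichletPDF hβ hβ)) (hint.sub (integrable_const _)) ?_
        filter_upwards [ae_dirichlet_mem hβ] with h hh
        have ha := (dirichletPDF_pos_iff hα).2 hh
        have hb := (dirichletPDF_pos_iff hβ).2 hh
        rw [← Real.log_div ha.ne' hb.ne']
        exact Real.log_le_sub_one_of_pos (div_pos ha hb)
    _ = 0 := by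
        rw [integral_sub hint (integrable_const _), h1]
        simp

end

/-! ### Finitely supported distributions: categorical and multinomial -/

section FiniteSupport

variable {Z : Type*} [MeasurableSpace Z] [MeasurableSingletonClass Z]
  {p : Z → ℝ} {s : Finset Z}

/-- As a finite sum of point masses the measure makes every function integrable and turns integrals
into finite sums. -/
theorem count_withDensity_eq_sum_dirac (hs : ∀ z, z ∉ s → p z = 0) :
    (Measure.count.withDensity fun z => ENNReal.ofReal (p z)) =
      ∑ z ∈ s, ENNReal.ofReal (p z) • Measure.dirac z := by
  ext A hA
  rw [withDensity_apply _ hA, ← lintegral_indicator hA, lintegral_count, tsum_eq_sum (s := s)]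
  · simp only [Measure.coe_finsetSum, Finset.sum_apply, Measure.smul_apply, smul_eq_mul,
      Measure.dirac_apply' _ hA]
    refine Finset.sum_congr rfl fun z _ => ?_
    by_cases hz : z ∈ A <;> simp [hz]
  · intro z hz
    by_cases hzA : z ∈ A <;> simp [hzA, hs z hz]

theorem isProbabilityMeasure_count_withDensity (hs : ∀ z, z ∉ s → p z = 0)
    (hp : ∀ z, 0 ≤ p z) (h1 : ∑ z ∈ s, p z = 1) :
    IsProbabilityMeasure (Measure.count.withDensity fun z => ENNReal.ofReal (p z)) := by
  refine ⟨?_⟩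
  rw [count_withDensity_eq_sum_dirac hs]
  simp [← ENNReal.ofReal_sum_of_nonneg fun z _ => hp z, h1]

theorem integrable_count_withDensity (hs : ∀ z, z ∉ s → p z = 0) (f : Z → ℝ) :
    Integrable f (Measure.count.withDensity fun z => ENNReal.ofReal (p z)) := by
  rw [count_withDensity_eq_sum_dirac hs, integrable_finsetSum_measure]
  exact fun z _ => (integrable_dirac (by simp)).smul_measure ENNReal.ofReal_ne_top

theorem integral_count_withDensity (hs : ∀ z, z ∉ s → p z = 0) (hp : ∀ z, 0 ≤ p z) (f : Z → ℝ) :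
    ∫ z, f z ∂(Measure.count.withDensity fun z => ENNReal.ofReal (p z)) =
      ∑ z ∈ s, p z * f z := by
  rw [count_withDensity_eq_sum_dirac hs, integral_finsetSum_measure]
  · simp [hp]
  · exact fun z _ => (integrable_dirac (by simp)).smul_measure ENNReal.ofReal_ne_top

theorem ae_count_withDensity_pos [Countable Z] :
    ∀ᵐ z ∂(Measure.count.withDensity fun z => ENNReal.ofReal (p z)), 0 < p z := by
  rw [ae_withDensity_iff (measurable_of_countable _)]
  refine Filter.Eventually.of_forall fun z hz => ?_
  by_contra hn
  exact hz (ENNReal.ofReal_of_nonpos (not_lt.1 hn))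

end FiniteSupport

section Categorical

variable {m : ℕ} {φ : Fin (m + 1) → ℝ}

theorem isProbabilityMeasure_categorical (hφ : φ ∈ stdSimplex ℝ (Fin (m + 1))) :
    IsProbabilityMeasure (categorical φ) :=
  isProbabilityMeasure_count_withDensity (s := Finset.univ) (by simp) hφ.1 hφ.2

theorem integrable_categorical (f : Fin (m + 1) → ℝ) : Integrable f (categorical φ) :=
  integrable_count_withDensity (s := Finset.univ) (by simp) f

theorem integral_categorical (hφ : φ ∈ stdSimplex ℝ (Fin (m + 1))) (f : Fin (m + 1) → ℝ) :
    ∫ k, f k ∂(categorical φ) = ∑ k, φ k * f k :=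
  integral_count_withDensity (s := Finset.univ) (by simp) hφ.1 f

theorem ae_categorical_pos : ∀ᵐ k ∂(categorical φ), 0 < φ k := ae_count_withDensity_pos

end Categorical

section Multinomial

variable {m : ℕ} {x : ℕ} {φ : Fin (m + 1) → ℝ}

theorem multinomialPMF_nonneg (hφ : φ ∈ stdSimplex ℝ (Fin (m + 1))) (z : Fin (m + 1) → ℕ) :
    0 ≤ multinomialPMF x φ z := by
  unfold multinomialPMF
  split_ifs
  · exact mul_nonneg (Nat.cast_nonneg _) (Finset.prod_nonneg fun k _ => pow_nonneg (hφ.1 k) _)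
  · exact le_rfl

theorem multinomialPMF_eq_zero {z : Fin (m + 1) → ℕ}
    (hz : z ∉ Finset.piAntidiag Finset.univ x) : multinomialPMF x φ z = 0 :=
  if_neg (by simpa [Finset.mem_piAntidiag] using hz)

theorem sum_multinomialPMF_mul (x : ℕ) (φ : Fin (m + 1) → ℝ) (f : (Fin (m + 1) → ℕ) → ℝ) :
    ∑ z ∈ Finset.piAntidiag Finset.univ x, multinomialPMF x φ z * f z =
      ∑ z ∈ Finset.piAntidiag Finset.univ x,
        (Nat.multinomial Finset.univ z : ℝ) * (∏ k, φ k ^ z k) * f z := by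
  refine Finset.sum_congr rfl fun z hz => ?_
  rw [multinomialPMF, if_pos (Finset.mem_piAntidiag.1 hz).1]

theorem isProbabilityMeasure_multinomial (hφ : φ ∈ stdSimplex ℝ (Fin (m + 1))) :
    IsProbabilityMeasure (multinomial x φ) := by
  refine isProbabilityMeasure_count_withDensity (fun z => multinomialPMF_eq_zero)
    (multinomialPMF_nonneg hφ) ?_
  have h := sum_multinomialPMF_mul x φ fun _ => 1
  simp only [mul_one] at h
  rw [h, ← Finset.sum_pow_eq_sum_piAntidiag, hφ.2, one_pow]

theorem integrable_multinomial (f : (Fin (m + 1) → ℕ) → ℝ) : Integrable f (multinomial x φ) :=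
  integrable_count_withDensity (fun _ => multinomialPMF_eq_zero) f

theorem ae_multinomialPMF_pos : ∀ᵐ z ∂(multinomial x φ), 0 < multinomialPMF x φ z :=
  ae_count_withDensity_pos

/-- The mean is the derivative at `t = 0` of the generating function `E[(1 + t) ^ z_k] = (1 + t φ_k)
^ x`. -/
theorem integral_multinomial (hφ : φ ∈ stdSimplex ℝ (Fin (m + 1))) (k : Fin (m + 1)) :
    ∫ z, (z k : ℝ) ∂(multinomial x φ) = x * φ k := by
  classical
  rw [multinomial, integral_count_withDensity (fun z => multinomialPMF_eq_zero)
    (multinomialPMF_nonneg hφ), sum_multinomialPMF_mul]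
  have hsum : ∀ t : ℝ, (1 + t * φ k) ^ x = ∑ z ∈ Finset.piAntidiag Finset.univ x,
      (Nat.multinomial Finset.univ z : ℝ) * (∏ j, φ j ^ z j) * (1 + t) ^ z k := by
    intro t
    -- The multinomial theorem is applied to the weights `φ` with the `k`-th one scaled by `1 + t`.
    have h1 : 1 + t * φ k = ∑ j, φ j * (if j = k then 1 + t else 1) := by
      have : ∀ j, φ j * (if j = k then 1 + t else 1) = φ j + if j = k then t * φ j else 0 := by
        intro j; split_ifs <;> ring
      simp [this, Finset.sum_add_distrib, hφ.2]
    rw [h1, Finset.sum_pow_eq_sum_piAntidiag]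
    refine Finset.sum_congr rfl fun z _ => ?_
    have h2 : ∀ j, (φ j * if j = k then 1 + t else 1) ^ z j =
        φ j ^ z j * if j = k then (1 + t) ^ z k else 1 := by
      intro j
      split_ifs with hj
      · rw [mul_pow, hj]
      · simp
    rw [Finset.prod_congr rfl fun j _ => h2 j, Finset.prod_mul_distrib, Finset.prod_ite_eq',
      if_pos (Finset.mem_univ k), mul_assoc]
  have hd1 : HasDerivAt (fun t : ℝ => (1 + t * φ k) ^ x) (x * φ k) 0 := by
    have h := (((hasDerivAt_id (0 : ℝ)).mul_const (φ k)).const_add 1).fun_pow x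
    simpa using h
  have hd2 : HasDerivAt (fun t : ℝ => ∑ z ∈ Finset.piAntidiag Finset.univ x,
      (Nat.multinomial Finset.univ z : ℝ) * (∏ j, φ j ^ z j) * (1 + t) ^ z k)
      (∑ z ∈ Finset.piAntidiag Finset.univ x,
        (Nat.multinomial Finset.univ z : ℝ) * (∏ j, φ j ^ z j) * z k) 0 := by
    refine HasDerivAt.fun_sum fun z _ => HasDerivAt.const_mul _ ?_
    have h := ((hasDerivAt_id (0 : ℝ)).const_add 1).fun_pow (z k)
    simpa using h
  simp_rw [← hsum] at hd2
  exact hd2.unique hd1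

/-- The factorials of the `z k` are kept apart because the Poisson densities contain the same ones.
A cell with `φ k = 0` has `z k = 0` here, so `Real.log 0 = 0` does no harm. -/
theorem log_multinomialPMF {z : Fin (m + 1) → ℕ} (hz : 0 < multinomialPMF x φ z) :
    ∑ k, z k = x ∧ Real.log (multinomialPMF x φ z) =
      ∑ k, z k * Real.log (φ k) +
        (Real.log (x.factorial : ℝ) - ∑ k, Real.log ((z k).factorial : ℝ)) := by
  unfold multinomialPMF at hz ⊢
  split_ifs at hz ⊢ with hx
  · refine ⟨hx, ?_⟩
    have hne : ∏ k, φ k ^ z k ≠ 0 := right_ne_zero_of_mul hz.ne'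
    have hm : (Nat.multinomial Finset.univ z : ℝ) ≠ 0 := left_ne_zero_of_mul hz.ne'
    have hspec : (∏ k, ((z k).factorial : ℝ)) * (Nat.multinomial Finset.univ z : ℝ) =
        (x.factorial : ℝ) := by
      rw [← hx]; exact_mod_cast Nat.multinomial_spec Finset.univ z
    have hf : ∀ k ∈ Finset.univ, ((z k).factorial : ℝ) ≠ 0 := fun k _ => by positivity
    rw [← hspec, Real.log_mul hm hne, Real.log_mul (Finset.prod_ne_zero_iff.2 hf) hm,
      Real.log_prod hf, Real.log_prod fun k hk => Finset.prod_ne_zero_iff.1 hne k hk]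
    simp only [Real.log_pow]
    ring
  · exact absurd hz (lt_irrefl _)

end Multinomial

/-! ### Poisson densities, including rate zero -/

theorem poissonPMF_eq {r : ℝ} (hr : 0 ≤ r) (n : ℕ) :
    poissonPMF r n = Real.exp (-r) * r ^ n / n.factorial := by
  rw [poissonPMF, ProbabilityTheory.poissonMeasure_real_singleton, Real.coe_toNNReal _ hr]

theorem poissonPMF_zero_of_ne_zero {n : ℕ} (hn : n ≠ 0) : poissonPMF 0 n = 0 := by
  simp [poissonPMF_eq le_rfl, hn]

/-- The case `w = 0`, `n = 0` must be included: rate zero puts all mass at `0`, and the default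
value of `Real.log w` is multiplied by `n = 0`. -/
theorem log_poissonPMF {w h : ℝ} (hw : 0 ≤ w) (hh : 0 < h) {n : ℕ} (hn : n ≠ 0 → 0 < w) :
    0 < poissonPMF (w * h) n ∧ Real.log (poissonPMF (w * h) n) =
      n * (Real.log h + Real.log w) - Real.log (n.factorial : ℝ) - w * h := by
  rw [poissonPMF_eq (mul_nonneg hw hh.le)]
  rcases eq_or_ne n 0 with rfl | h0
  · simp [Real.exp_pos]
  · have hw' := hn h0
    have hf : (0 : ℝ) < n.factorial := by positivity
    refine ⟨by positivity, ?_⟩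
    rw [Real.log_div (by positivity) hf.ne', Real.log_mul (by positivity) (by positivity),
      Real.log_exp, Real.log_pow, Real.log_mul hw'.ne' hh.ne']
    ring

/-! ### Expected log densities of a single document -/

section Document

variable {m : ℕ} {α β : Fin (m + 1) → ℝ} {Z ι : Type*} [MeasurableSpace Z] [Fintype ι]
  {ρ : Measure Z} [IsProbabilityMeasure ρ] {c : ι → Fin (m + 1) → Z → ℝ} {g : Z → ℝ}

/-- The general form of the log densities of one document: `h` are the topic proportions, `z` the
latent allocations, and `c i k z` counts the allocations of item `i` to topic `k`. -/
noncomputable def docLog (α : Fin (m + 1) → ℝ) (c : ι → Fin (m + 1) → Z → ℝ) (g : Z → ℝ) (s r : ℝ)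
    (l : ι → Fin (m + 1) → ℝ) (ω : (Fin (m + 1) → ℝ) × Z) : ℝ :=
  Real.log (dirichletPDF α ω.1) + ∑ i, ∑ k, (s * (Real.log (ω.1 k) * c i k ω.2) + l i k * c i k ω.2)
    + g ω.2 + r

theorem integrable_docLog (hα : ∀ k, 0 < α k) (hβ : ∀ k, 0 < β k)
    (hc : ∀ i k, Integrable (c i k) ρ) (hg : Integrable g ρ) (s r : ℝ)
    (l : ι → Fin (m + 1) → ℝ) :
    Integrable (docLog α c g s r l) ((dirichlet β).prod ρ) := by
  have := isProbabilityMeasure_dirichlet hβ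
  refine (((integrable_log_dirichletPDF hα hβ).comp_fst ρ).add
    (integrable_finsetSum _ fun i _ => integrable_finsetSum _ fun k _ => ?_)).add
      (hg.comp_snd _) |>.add (integrable_const r)
  exact (((integrable_log_dirichlet hβ k).mul_prod (hc i k)).const_mul s).add
    (((hc i k).comp_snd _).const_mul _)

theorem integral_docLog (hα : ∀ k, 0 < α k) (hβ : ∀ k, 0 < β k)
    (hc : ∀ i k, Integrable (c i k) ρ) (hg : Integrable g ρ) (s r : ℝ)
    (l : ι → Fin (m + 1) → ℝ) :
    ∫ ω, docLog α c g s r l ω ∂((dirichlet β).prod ρ) =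
      ∫ h, Real.log (dirichletPDF α h) ∂(dirichlet β) +
      ∑ i, ∑ k, (∫ z, c i k z ∂ρ) * (s * ∫ h, Real.log (h k) ∂(dirichlet β) + l i k) +
      ∫ z, g z ∂ρ + r := by
  have := isProbabilityMeasure_dirichlet hβ
  have h1 := (integrable_log_dirichletPDF hα hβ).comp_fst ρ
  have hA : ∀ i k, Integrable (fun ω : (Fin (m + 1) → ℝ) × Z =>
      s * (Real.log (ω.1 k) * c i k ω.2)) ((dirichlet β).prod ρ) := fun i k =>
    ((integrable_log_dirichlet hβ k).mul_prod (hc i k)).const_mul s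
  have hB : ∀ i k, Integrable (fun ω : (Fin (m + 1) → ℝ) × Z => l i k * c i k ω.2)
      ((dirichlet β).prod ρ) := fun i k => ((hc i k).comp_snd _).const_mul _
  have h2 : Integrable (fun ω : (Fin (m + 1) → ℝ) × Z => ∑ i, ∑ k,
      (s * (Real.log (ω.1 k) * c i k ω.2) + l i k * c i k ω.2)) ((dirichlet β).prod ρ) :=
    integrable_finsetSum _ fun i _ => integrable_finsetSum _ fun k _ => (hA i k).fun_add (hB i k)
  have h3 : Integrable (fun ω : (Fin (m + 1) → ℝ) × Z => g ω.2) ((dirichlet β).prod ρ) :=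
    hg.comp_snd _
  have h12 := h1.fun_add h2
  have h123 := h12.fun_add h3
  unfold docLog
  rw [integral_add h123 (integrable_const r), integral_add h12 h3,
    integral_add h1 h2, integral_finsetSum _ fun i _ => integrable_finsetSum _ fun k _ =>
      (hA i k).fun_add (hB i k)]
  congr 1
  · congr 1
    · congr 1
      · rw [integral_fun_fst (μ := dirichlet β) (ν := ρ) (fun h => Real.log (dirichletPDF α h))]
        simp
      · refine Finset.sum_congr rfl fun i _ => ?_
        rw [integral_finsetSum _ fun k _ => (hA i k).fun_add (hB i k)]
        refine Finset.sum_congr rfl fun k _ => ?_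
        -- Independence of proportions and allocations factors the expectation of `log h_k` times a
        -- count.
        rw [integral_add (hA i k) (hB i k), integral_const_mul, integral_const_mul,
          integral_prod_mul (μ := dirichlet β) (ν := ρ) (fun h => Real.log (h k)) (c i k),
          integral_fun_snd (μ := dirichlet β) (ν := ρ) (c i k)]
        simp only [probReal_univ, one_smul]
        ring
    · rw [integral_fun_snd (μ := dirichlet β) (ν := ρ) g]
      simp
  · simp

end Document

/-! ### Lower bounds for independent documents -/

section Documents

variable {D : ℕ} {Ω : Fin D → Type*} [∀ d, MeasurableSpace (Ω d)] {μ : ∀ d, Measure (Ω d)}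
  [∀ d, IsProbabilityMeasure (μ d)] {P Q LP LQ : ∀ d, Ω d → ℝ}

theorem ae_prod_pos_and_log (h : ∀ d, ∀ᵐ x ∂(μ d), 0 < P d x ∧ Real.log (P d x) = LP d x) :
    ∀ᵐ ω ∂(Measure.pi μ), 0 < ∏ d, P d (ω d) ∧
      Real.log (∏ d, P d (ω d)) = ∑ d, LP d (ω d) := by
  have h' : ∀ᵐ ω ∂(Measure.pi μ), ∀ d, 0 < P d (ω d) ∧ Real.log (P d (ω d)) = LP d (ω d) :=
    ae_all_iff.2 fun d => (measurePreserving_eval μ d).quasiMeasurePreserving.ae (h d)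
  filter_upwards [h'] with ω hω
  refine ⟨Finset.prod_pos fun d _ => (hω d).1, ?_⟩
  rw [Real.log_prod fun d _ => (hω d).1.ne']
  exact Finset.sum_congr rfl fun d _ => (hω d).2

theorem integrable_sum_pi (h : ∀ d, Integrable (LP d) (μ d)) :
    Integrable (fun ω => ∑ d, LP d (ω d)) (Measure.pi μ) :=
  integrable_finsetSum _ fun d _ => (measurePreserving_eval μ d).integrable_comp_of_integrable (h d)

theorem integral_eval_pi {d : Fin D} {f : Ω d → ℝ} (h : Integrable f (μ d)) :
    ∫ ω, f (ω d) ∂(Measure.pi μ) = ∫ x, f x ∂(μ d) := by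
  have hm := (measurePreserving_eval μ d)
  conv_rhs => rw [← hm.map_eq]
  rw [integral_map hm.measurable.aemeasurable (by rw [hm.map_eq]; exact h.aestronglyMeasurable)]

theorem integral_sum_pi (h : ∀ d, Integrable (LP d) (μ d)) :
    ∫ ω, ∑ d, LP d (ω d) ∂(Measure.pi μ) = ∑ d, ∫ x, LP d x ∂(μ d) := by
  have h' : ∀ d, Integrable (fun ω : (∀ d, Ω d) => LP d (ω d)) (Measure.pi μ) := fun d =>
    (measurePreserving_eval μ d).integrable_comp_of_integrable (h d)
  rw [integral_finsetSum _ fun d _ => h' d]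
  exact Finset.sum_congr rfl fun d _ => integral_eval_pi (h d)

theorem elbo_pi_of_pos
    (hQ : ∀ d, ∀ᵐ x ∂(μ d), 0 < Q d x ∧ Real.log (Q d x) = LQ d x)
    (hQi : ∀ d, Integrable (LQ d) (μ d))
    (hP : ∀ d, ∀ᵐ x ∂(μ d), 0 < P d x ∧ Real.log (P d x) = LP d x)
    (hPi : ∀ d, Integrable (LP d) (μ d)) :
    ElboWellDefined (Measure.pi μ) (fun ω => ∏ d, P d (ω d)) (fun ω => ∏ d, Q d (ω d)) ∧
      elbo (Measure.pi μ) (fun ω => ∏ d, P d (ω d)) (fun ω => ∏ d, Q d (ω d)) =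
        ((∑ d, (∫ x, LP d x ∂(μ d) - ∫ x, LQ d x ∂(μ d)) : ℝ) : EReal) := by
  have hq := ae_prod_pos_and_log hQ
  have hp := ae_prod_pos_and_log hP
  have hqe : (fun ω => Real.log (∏ d, Q d (ω d))) =ᵐ[Measure.pi μ] fun ω => ∑ d, LQ d (ω d) :=
    hq.mono fun _ h => h.2
  have hpe : (fun ω => Real.log (∏ d, P d (ω d))) =ᵐ[Measure.pi μ] fun ω => ∑ d, LP d (ω d) :=
    hp.mono fun _ h => h.2
  refine ⟨⟨inferInstance, hq.mono fun _ h => h.1, (integrable_sum_pi hQi).congr hqe.symm,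
    fun _ => (integrable_sum_pi hPi).congr hpe.symm⟩, ?_⟩
  rw [elbo, expLog, expLog, if_pos (hp.mono fun _ h => h.1), if_pos (hq.mono fun _ h => h.1),
    integral_congr_ae hqe, integral_congr_ae hpe, integral_sum_pi hQi, integral_sum_pi hPi,
    ← EReal.coe_sub, Finset.sum_sub_distrib]

/-- The function `f` is a witness that `P d` vanishes with positive probability: if the joint
density were almost surely positive, `f` would vanish almost surely and have mean zero. -/
theorem elbo_pi_of_eq_zero
    (hQ : ∀ d, ∀ᵐ x ∂(μ d), 0 < Q d x ∧ Real.log (Q d x) = LQ d x)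
    (hQi : ∀ d, Integrable (LQ d) (μ d))
    {d : Fin D} {f : Ω d → ℝ} (hf : Integrable f (μ d)) (hne : ∫ x, f x ∂(μ d) ≠ 0)
    (hP : ∀ x, f x ≠ 0 → P d x = 0) :
    ElboWellDefined (Measure.pi μ) (fun ω => ∏ d, P d (ω d)) (fun ω => ∏ d, Q d (ω d)) ∧
      elbo (Measure.pi μ) (fun ω => ∏ d, P d (ω d)) (fun ω => ∏ d, Q d (ω d)) = ⊥ := by
  have hq := ae_prod_pos_and_log hQ
  have hqe : (fun ω => Real.log (∏ d, Q d (ω d))) =ᵐ[Measure.pi μ] fun ω => ∑ d, LQ d (ω d) :=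
    hq.mono fun _ h => h.2
  have hn : ¬ ∀ᵐ ω ∂(Measure.pi μ), 0 < ∏ d, P d (ω d) := by
    intro h
    apply hne
    rw [← integral_eval_pi hf]
    refine integral_eq_zero_of_ae (h.mono fun ω hω => ?_)
    by_contra h0
    exact hω.ne' (Finset.prod_eq_zero (Finset.mem_univ d) (hP _ h0))
  refine ⟨⟨inferInstance, hq.mono fun _ h => h.1, (integrable_sum_pi hQi).congr hqe.symm,
    fun h => absurd h hn⟩, ?_⟩
  rw [elbo, expLog, expLog, if_neg hn, if_pos (hq.mono fun _ h => h.1), EReal.bot_sub]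

end Documents

/-! ### The lower bound in the form shared by both models -/

section MeanField

variable {D m : ℕ} {α : Fin (m + 1) → ℝ} {β : Fin (m + 1) → Fin D → ℝ} {Z ι : Fin D → Type*}
  [∀ d, MeasurableSpace (Z d)] [∀ d, Fintype (ι d)]
  {ρ : ∀ d, Measure (Z d)} [∀ d, IsProbabilityMeasure (ρ d)]
  {c : ∀ d, ι d → Fin (m + 1) → Z d → ℝ} {g : ∀ d, Z d → ℝ} {rP rQ : Fin D → ℝ}
  {lP lQ : ∀ d, ι d → Fin (m + 1) → ℝ} {P Q : ∀ d, (Fin (m + 1) → ℝ) × Z d → ℝ}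

/-- The contribution of the topic proportions of document `d` to the lower bounds. -/
noncomputable def dirichletGain (α : Fin (m + 1) → ℝ) (β : Fin (m + 1) → Fin D → ℝ)
    (d : Fin D) : ℝ :=
  ∫ h, Real.log (dirichletPDF α h) ∂(dirichlet fun k => β k d) -
    ∫ h, Real.log (dirichletPDF (fun k => β k d) h) ∂(dirichlet fun k => β k d)

/-- The switch of `docLog` is `1` for the model and `0` for the variational density, so `E_q[log
h_k]` enters once per expected count. Both use the same `g`, which drops out. -/
theorem elbo_meanField_of_pos (hα : ∀ k, 0 < α k) (hβ : IsDirichletParam β)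
    (hc : ∀ d i k, Integrable (c d i k) (ρ d)) (hg : ∀ d, Integrable (g d) (ρ d))
    (hQ : ∀ d, ∀ᵐ x ∂((dirichlet fun k => β k d).prod (ρ d)), 0 < Q d x ∧
      Real.log (Q d x) = docLog (fun k => β k d) (c d) (g d) 0 (rQ d) (lQ d) x)
    (hP : ∀ d, ∀ᵐ x ∂((dirichlet fun k => β k d).prod (ρ d)), 0 < P d x ∧
      Real.log (P d x) = docLog α (c d) (g d) 1 (rP d) (lP d) x) :
    let q := Measure.pi fun d => (dirichlet fun k => β k d).prod (ρ d)
    ElboWellDefined q (fun ω => ∏ d, P d (ω d)) (fun ω => ∏ d, Q d (ω d)) ∧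
      elbo q (fun ω => ∏ d, P d (ω d)) (fun ω => ∏ d, Q d (ω d)) =
        ((∑ d, (dirichletGain α β d + ∑ i, ∑ k, (∫ z, c d i k z ∂(ρ d)) *
          (meanLog β k d + lP d i k - lQ d i k) + rP d - rQ d) : ℝ) : EReal) := by
  have hβ' : ∀ d, ∀ k, 0 < β k d := fun d k => hβ k d
  have : ∀ d, IsProbabilityMeasure (dirichlet fun k => β k d) := fun d =>
    isProbabilityMeasure_dirichlet (hβ' d)
  obtain ⟨h1, h2⟩ := elbo_pi_of_pos hQ
    (fun d => integrable_docLog (hβ' d) (hβ' d) (hc d) (hg d) _ _ _) hP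
    (fun d => integrable_docLog hα (hβ' d) (hc d) (hg d) _ _ _)
  refine ⟨h1, h2.trans ?_⟩
  congr 1
  refine Finset.sum_congr rfl fun d _ => ?_
  rw [integral_docLog hα (hβ' d) (hc d) (hg d), integral_docLog (hβ' d) (hβ' d) (hc d) (hg d),
    dirichletGain]
  simp only [mul_sub, mul_add, Finset.sum_add_distrib, Finset.sum_sub_distrib, meanLog]
  simp only [zero_mul, mul_zero, one_mul, Finset.sum_const_zero]
  ring

theorem elbo_meanField_of_eq_zero (hβ : IsDirichletParam β)
    (hc : ∀ d i k, Integrable (c d i k) (ρ d)) (hg : ∀ d, Integrable (g d) (ρ d))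
    (hQ : ∀ d, ∀ᵐ x ∂((dirichlet fun k => β k d).prod (ρ d)), 0 < Q d x ∧
      Real.log (Q d x) = docLog (fun k => β k d) (c d) (g d) 0 (rQ d) (lQ d) x)
    {d : Fin D} {i : ι d} {k : Fin (m + 1)} (hne : ∫ z, c d i k z ∂(ρ d) ≠ 0)
    (hP : ∀ x, c d i k x.2 ≠ 0 → P d x = 0) :
    let q := Measure.pi fun d => (dirichlet fun k => β k d).prod (ρ d)
    ElboWellDefined q (fun ω => ∏ d, P d (ω d)) (fun ω => ∏ d, Q d (ω d)) ∧
      elbo q (fun ω => ∏ d, P d (ω d)) (fun ω => ∏ d, Q d (ω d)) = ⊥ := by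
  have hβ' : ∀ d, ∀ k, 0 < β k d := fun d k => hβ k d
  have : ∀ d, IsProbabilityMeasure (dirichlet fun k => β k d) := fun d =>
    isProbabilityMeasure_dirichlet (hβ' d)
  refine elbo_pi_of_eq_zero hQ
    (fun d => integrable_docLog (hβ' d) (hβ' d) (hc d) (hg d) _ _ _)
    ((hc d i k).comp_snd _) ?_ hP
  rw [integral_fun_snd (μ := dirichlet fun k => β k d) (ν := ρ d) (c d i k)]
  simpa using hne

end MeanField

/-! ### The explicit bound and its finiteness -/

section Bound

variable {V D m : ℕ} {α : Fin (m + 1) → ℝ} {W : Fin V → Fin (m + 1) → ℝ}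
  {β : Fin (m + 1) → Fin D → ℝ} {φ : Fin V → Fin (m + 1) → Fin D → ℝ}

/-- Every term assigned to a topic with positive probability has positive weight in the topic. -/
def IsSupported (X : Fin V → Fin D → ℝ) (W : Fin V → Fin (m + 1) → ℝ)
    (φ : Fin V → Fin (m + 1) → Fin D → ℝ) : Prop :=
  ∀ v k d, 0 < X v d * φ v k d → 0 < W v k

/-- The value of `ldaBound` when it is finite, as a sum over the documents. -/
noncomputable def finiteBound (X : Fin V → Fin D → ℝ) (α : Fin (m + 1) → ℝ)
    (W : Fin V → Fin (m + 1) → ℝ) (β : Fin (m + 1) → Fin D → ℝ)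
    (φ : Fin V → Fin (m + 1) → Fin D → ℝ) : ℝ :=
  ∑ d, (dirichletGain α β d + ∑ v, ∑ k, X v d * φ v k d *
    (meanLog β k d + Real.log (W v k) - Real.log (φ v k d)))

/-- The gain is minus the Kullback-Leibler divergence between two Dirichlet distributions, here in
closed form. -/
theorem dirichletGain_eq (hα : ∀ k, 0 < α k) (hβ : IsDirichletParam β) (d : Fin D) :
    dirichletGain α β d =
      Real.log (Real.Gamma (∑ k, α k)) - Real.log (Real.Gamma (∑ k, β k d)) +
      ∑ k, (Real.log (Real.Gamma (β k d)) - Real.log (Real.Gamma (α k)) +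
        (α k - β k d) * meanLog β k d) := by
  have hβ' : ∀ k, 0 < β k d := fun k => hβ k d
  rw [dirichletGain, integral_log_dirichletPDF hα hβ', integral_log_dirichletPDF hβ' hβ']
  simp only [sub_mul, Finset.sum_add_distrib, Finset.sum_sub_distrib, meanLog]
  ring

theorem ereal_coe_sum {ι : Type*} (s : Finset ι) (f : ι → ℝ) :
    ((∑ i ∈ s, f i : ℝ) : EReal) = ∑ i ∈ s, (f i : EReal) := by
  classical
  induction s using Finset.induction_on with
  | empty => simp
  | insert a s ha ih => rw [Finset.sum_insert ha, Finset.sum_insert ha, EReal.coe_add, ih]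

/-- In `EReal` the value `⊥` absorbs every summand, even `⊤`. -/
theorem ereal_sum_eq_bot {ι : Type*} {s : Finset ι} {f : ι → EReal} {i : ι} (hi : i ∈ s)
    (h : f i = ⊥) : ∑ i ∈ s, f i = ⊥ := by
  classical
  rw [← Finset.add_sum_erase s f hi, h, EReal.bot_add]

theorem ldaBound_of_isSupported (hα : ∀ k, 0 < α k) (hβ : IsDirichletParam β)
    (hφ : IsAssignment φ) {X : Fin V → Fin D → ℕ}
    (hs : IsSupported (fun v d => (X v d : ℝ)) W φ) :
    ldaBound X α W β φ = ((finiteBound (fun v d => (X v d : ℝ)) α W β φ : ℝ) : EReal) := by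
  have hterm : ∀ v k d, (((X v d : ℝ) * φ v k d : ℝ) : EReal) *
      ENNReal.log (ENNReal.ofReal (W v k * hTilde β k d / φ v k d)) =
      (((X v d : ℝ) * φ v k d *
        (meanLog β k d + Real.log (W v k) - Real.log (φ v k d)) : ℝ) : EReal) := by
    intro v k d
    have h0 : 0 ≤ φ v k d := (hφ v d).1 k
    rcases (mul_nonneg (Nat.cast_nonneg (X v d)) h0).eq_or_lt with h | h
    -- With coefficient zero both sides vanish, whatever the logarithms are.
    · rw [← h]; simp
    · have hW := hs v k d h
      have hp : 0 < φ v k d := h0.lt_of_ne fun h' => by simp [← h'] at h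
      rw [ENNReal.log_ofReal_of_pos (by unfold hTilde; positivity), ← EReal.coe_mul,
        Real.log_div (by unfold hTilde; positivity) hp.ne',
        Real.log_mul hW.ne' (by unfold hTilde; positivity), hTilde, Real.log_exp,
        add_comm (Real.log (W v k))]
  simp only [ldaBound, hterm]
  simp only [← ereal_coe_sum]
  rw [← EReal.coe_add]
  congr 1
  simp only [finiteBound, dirichletGain_eq hα hβ]
  rw [Finset.sum_add_distrib, Finset.sum_add_distrib]
  rw [Finset.sum_comm (f := fun k d => Real.log (Real.Gamma (β k d)) - Real.log (Real.Gamma (α k))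
    + (α k - β k d) * meanLog β k d), add_comm, Finset.sum_comm (t := (Finset.univ : Finset (Fin V)))]
  congr 1
  refine Finset.sum_congr rfl fun v _ => ?_
  rw [Finset.sum_comm]

theorem ldaBound_of_not_isSupported (hW : IsTopicMatrix W) {X : Fin V → Fin D → ℕ}
    (hs : ¬ IsSupported (fun v d => (X v d : ℝ)) W φ) :
    ldaBound X α W β φ = ⊥ := by
  unfold IsSupported at hs
  push Not at hs
  obtain ⟨v, k, d, h1, h2⟩ := hs
  have h0 : W v k = 0 := le_antisymm h2 ((hW k).1 v)
  have hbot : (((X v d : ℝ) * φ v k d : ℝ) : EReal) *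
      ENNReal.log (ENNReal.ofReal (W v k * hTilde β k d / φ v k d)) = ⊥ := by
    rw [h0, zero_mul, zero_div, ENNReal.ofReal_zero, ENNReal.log_zero,
      EReal.coe_mul_bot_of_pos h1]
  rw [ldaBound, ereal_sum_eq_bot (Finset.mem_univ v) (ereal_sum_eq_bot (Finset.mem_univ k)
    (ereal_sum_eq_bot (Finset.mem_univ d) hbot)), EReal.bot_add]

end Bound

/-! ### The lower bound of the Dirichlet–Poisson model -/

section DirichletPoissonModel

variable {V D m : ℕ} {α : Fin (m + 1) → ℝ} {W : Fin V → Fin (m + 1) → ℝ}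
  {β : Fin (m + 1) → Fin D → ℝ} {φ : Fin V → Fin (m + 1) → Fin D → ℝ}

theorem dpElbo_eq (hα : ∀ k, 0 < α k) (X : Fin V → Fin D → ℕ) (hW : IsTopicMatrix W)
    (hβ : IsDirichletParam β) (hφ : IsAssignment φ) :
    ElboWellDefined (dpVar X β φ) (dpJoint X α W) (dpVarDens X β φ) ∧
      dpElbo X α W β φ = ldaBound X α W β φ +
        ((-(D : ℝ) - ∑ v, ∑ d, Real.log ((X v d).factorial : ℝ) : ℝ) : EReal) := by
  have hβ' : ∀ d, ∀ k, 0 < β k d := fun d k => hβ k d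
  have hdp : ∀ d, IsProbabilityMeasure (dirichlet fun k => β k d) := fun d =>
    isProbabilityMeasure_dirichlet (hβ' d)
  have hmp : ∀ d v, IsProbabilityMeasure (multinomial (X v d) fun k => φ v k d) := fun d v =>
    isProbabilityMeasure_multinomial (hφ v d)
  let ρ : Fin D → Measure (Fin V → Fin (m + 1) → ℕ) := fun d =>
    Measure.pi fun v => multinomial (X v d) fun k => φ v k d
  have hmp' : ∀ d, IsProbabilityMeasure (ρ d) := fun d => by infer_instance
  have hev : ∀ d v, MeasurePreserving (Function.eval v) (ρ d)
      (multinomial (X v d) fun k => φ v k d) := fun d v => measurePreserving_eval _ v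
  let c : Fin D → Fin V → Fin (m + 1) → (Fin V → Fin (m + 1) → ℕ) → ℝ :=
    fun _ v k z => (z v k : ℝ)
  -- The log factorials shared by the multinomial and Poisson densities; their expectation is never
  -- computed.
  let g : Fin D → (Fin V → Fin (m + 1) → ℕ) → ℝ :=
    fun _ z => ∑ v, -∑ k, Real.log ((z v k).factorial : ℝ)
  have hc : ∀ d v k, Integrable (c d v k) (ρ d) := fun d v k =>
    (hev d v).integrable_comp_of_integrable (integrable_multinomial fun z => (z k : ℝ))
  have hg : ∀ d, Integrable (g d) (ρ d) := fun d => integrable_finsetSum _ fun v _ =>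
    (hev d v).integrable_comp_of_integrable
      (integrable_multinomial fun z => -∑ k, Real.log ((z k).factorial : ℝ))
  have hci : ∀ d v k, ∫ z, c d v k z ∂(ρ d) = X v d * φ v k d := by
    intro d v k
    rw [← integral_multinomial (hφ v d) k, ← (hev d v).map_eq,
      integral_map (hev d v).measurable.aemeasurable
        (measurable_of_countable _).aestronglyMeasurable]
  have hae : ∀ d, ∀ᵐ x ∂((dirichlet fun k => β k d).prod (ρ d)),
      ((∀ k, 0 < x.1 k) ∧ ∑ k, x.1 k = 1) ∧
        ∀ v, 0 < multinomialPMF (X v d) (fun k => φ v k d) (x.2 v) := by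
    intro d
    refine (Measure.quasiMeasurePreserving_fst.ae (ae_dirichlet_mem (hβ' d))).and
      (Measure.quasiMeasurePreserving_snd.ae (ae_all_iff.2 fun v =>
        (hev d v).quasiMeasurePreserving.ae ae_multinomialPMF_pos))
  have hQ : ∀ d, ∀ᵐ x ∂((dirichlet fun k => β k d).prod (ρ d)),
      0 < dirichletPDF (fun k => β k d) x.1 *
        ∏ v, multinomialPMF (X v d) (fun k => φ v k d) (x.2 v) ∧
      Real.log (dirichletPDF (fun k => β k d) x.1 *
        ∏ v, multinomialPMF (X v d) (fun k => φ v k d) (x.2 v)) =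
      docLog (fun k => β k d) (c d) (g d) 0 (∑ v, Real.log ((X v d).factorial : ℝ))
        (fun v k => Real.log (φ v k d)) x := by
    intro d
    filter_upwards [hae d] with x hx
    have h1 := (dirichletPDF_pos_iff (hβ' d)).2 hx.1
    have h2 : 0 < ∏ v, multinomialPMF (X v d) (fun k => φ v k d) (x.2 v) :=
      Finset.prod_pos fun v _ => hx.2 v
    refine ⟨mul_pos h1 h2, ?_⟩
    rw [Real.log_mul h1.ne' h2.ne', Real.log_prod fun v _ => (hx.2 v).ne']
    simp only [(log_multinomialPMF (hx.2 _)).2, docLog, c, g, zero_mul, zero_add,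
      Finset.sum_add_distrib, Finset.sum_sub_distrib, Finset.sum_neg_distrib,
      mul_comm (Real.log (φ _ _ d))]
    ring
  by_cases hs : IsSupported (fun v d => (X v d : ℝ)) W φ
  · have hP : ∀ d, ∀ᵐ x ∂((dirichlet fun k => β k d).prod (ρ d)),
        0 < (∏ v, if ∑ k, x.2 v k = X v d then (1 : ℝ) else 0) * dirichletPDF α x.1 *
          ∏ v, ∏ k, poissonPMF (W v k * x.1 k) (x.2 v k) ∧
        Real.log ((∏ v, if ∑ k, x.2 v k = X v d then (1 : ℝ) else 0) * dirichletPDF α x.1 *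
          ∏ v, ∏ k, poissonPMF (W v k * x.1 k) (x.2 v k)) =
        docLog α (c d) (g d) 1 (-1) (fun v k => Real.log (W v k)) x := by
      intro d
      filter_upwards [hae d] with x hx
      have h1 := (dirichletPDF_pos_iff hα).2 hx.1
      have h2 : (∏ v, if ∑ k, x.2 v k = X v d then (1 : ℝ) else 0) = 1 :=
        Finset.prod_eq_one fun v _ => if_pos (log_multinomialPMF (hx.2 v)).1
      have h3 : ∀ v k, 0 < poissonPMF (W v k * x.1 k) (x.2 v k) ∧
          Real.log (poissonPMF (W v k * x.1 k) (x.2 v k)) =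
          x.2 v k * (Real.log (x.1 k) + Real.log (W v k)) -
            Real.log ((x.2 v k).factorial : ℝ) - W v k * x.1 k := by
        intro v k
        -- A nonzero `z_vk` of positive multinomial probability forces `φ_vk > 0` and `x_v > 0`,
        -- hence `w_vk > 0` by support.
        refine log_poissonPMF ((hW k).1 v) (hx.1.1 k) fun hne => hs v k d ?_
        have h4 := hx.2 v
        have h5 := (log_multinomialPMF h4).1
        rw [multinomialPMF, if_pos h5] at h4
        have h6 : φ v k d ^ x.2 v k ≠ 0 :=
          Finset.prod_ne_zero_iff.1 (right_ne_zero_of_mul h4.ne') k (Finset.mem_univ k)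
        have h7 : φ v k d ≠ 0 := fun h => h6 (by rw [h, zero_pow hne])
        have h8 : X v d ≠ 0 := by
          rw [← h5]
          exact fun h => hne (Finset.sum_eq_zero_iff.1 h k (Finset.mem_univ k))
        exact mul_pos (Nat.cast_pos.2 (Nat.pos_of_ne_zero h8))
          (((hφ v d).1 k).lt_of_ne' h7)
      have h9 : ∀ v, 0 < ∏ k, poissonPMF (W v k * x.1 k) (x.2 v k) := fun v =>
        Finset.prod_pos fun k _ => (h3 v k).1
      -- The Poisson rates of a document sum to one. This is the `-1` in `docLog`, and summed over
      -- documents the `-D`.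
      have h10 : ∑ v, ∑ k, W v k * x.1 k = 1 := by
        rw [Finset.sum_comm]
        simp only [← Finset.sum_mul, (hW _).2, one_mul, hx.1.2]
      rw [h2, one_mul]
      have h11 := Finset.prod_pos fun v (_ : v ∈ Finset.univ) => h9 v
      refine ⟨mul_pos h1 h11, ?_⟩
      rw [Real.log_mul h1.ne' h11.ne', Real.log_prod fun v _ => (h9 v).ne']
      have h12 : ∀ v, Real.log (∏ k, poissonPMF (W v k * x.1 k) (x.2 v k)) =
          ∑ k, (x.2 v k * (Real.log (x.1 k) + Real.log (W v k)) -
            Real.log ((x.2 v k).factorial : ℝ) - W v k * x.1 k) := fun v => by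
        rw [Real.log_prod fun k _ => (h3 v k).1.ne']
        exact Finset.sum_congr rfl fun k _ => (h3 v k).2
      simp only [h12, docLog, c, g, one_mul, Finset.sum_sub_distrib, h10, mul_add,
        Finset.sum_neg_distrib, mul_comm (Real.log _)]
      ring
    obtain ⟨h1, h2⟩ := elbo_meanField_of_pos hα hβ hc hg hQ hP
    refine ⟨h1, h2.trans ?_⟩
    rw [ldaBound_of_isSupported hα hβ hφ hs, ← EReal.coe_add]
    congr 1
    rw [finiteBound, Finset.sum_comm (f := fun v d => Real.log ((X v d).factorial : ℝ))]
    simp only [hci, Finset.sum_sub_distrib, Finset.sum_add_distrib]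
    simp
    ring
  · have hs' := hs
    unfold IsSupported at hs'
    push Not at hs'
    obtain ⟨v, k, d, h1, h2⟩ := hs'
    have h0 : W v k = 0 := le_antisymm h2 ((hW k).1 v)
    rw [ldaBound_of_not_isSupported hW hs, EReal.bot_add]
    -- The count `z_vk` has positive mean under `q`, but its Poisson rate in the model is zero.
    refine elbo_meanField_of_eq_zero (d := d) (i := v) (k := k)
      (P := fun d (x : (Fin (m + 1) → ℝ) × (Fin V → Fin (m + 1) → ℕ)) =>
        (∏ v, if ∑ k, x.2 v k = X v d then (1 : ℝ) else 0) * dirichletPDF α x.1 *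
          ∏ v, ∏ k, poissonPMF (W v k * x.1 k) (x.2 v k)) hβ hc hg hQ
      (by rw [hci]; exact h1.ne') fun x hx => ?_
    refine mul_eq_zero_of_right _ (Finset.prod_eq_zero (Finset.mem_univ v)
      (Finset.prod_eq_zero (Finset.mem_univ k) ?_))
    rw [h0, zero_mul]
    exact poissonPMF_zero_of_ne_zero fun h => hx (by simp [c, h])

end DirichletPoissonModel

/-! ### The lower bound of LDA -/

section LDAModel

variable {V D m : ℕ} {α : Fin (m + 1) → ℝ} {W : Fin V → Fin (m + 1) → ℝ}
  {β : Fin (m + 1) → Fin D → ℝ} {φ : Fin V → Fin (m + 1) → Fin D → ℝ}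

theorem sum_wordCount_mul {N : Fin D → ℕ} (ν : (d : Fin D) → Fin (N d) → Fin V) (d : Fin D)
    (f : Fin V → ℝ) : ∑ v, (wordCount ν v d : ℝ) * f v = ∑ n, f (ν d n) := by
  rw [← Finset.sum_fiberwise Finset.univ (ν d) fun n => f (ν d n)]
  refine Finset.sum_congr rfl fun v _ => ?_
  rw [Finset.sum_congr rfl fun n hn => by rw [(Finset.mem_filter.1 hn).2], Finset.sum_const,
    nsmul_eq_mul, wordCount]

theorem wordCount_pos_iff {N : Fin D → ℕ} (ν : (d : Fin D) → Fin (N d) → Fin V) (v : Fin V)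
    (d : Fin D) : 0 < wordCount ν v d ↔ ∃ n, ν d n = v := by
  simp [wordCount, Finset.card_pos, Finset.filter_nonempty_iff]

theorem ldaElbo_eq (hα : ∀ k, 0 < α k) {N : Fin D → ℕ} (ν : (d : Fin D) → Fin (N d) → Fin V)
    (hW : IsTopicMatrix W) (hβ : IsDirichletParam β) (hφ : IsAssignment φ) :
    ElboWellDefined (ldaVar ν β φ) (ldaJoint ν α W) (ldaVarDens ν β φ) ∧
      ldaElbo ν α W β φ = ldaBound (wordCount ν) α W β φ := by
  have hβ' : ∀ d, ∀ k, 0 < β k d := fun d k => hβ k d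
  have hdp : ∀ d, IsProbabilityMeasure (dirichlet fun k => β k d) := fun d =>
    isProbabilityMeasure_dirichlet (hβ' d)
  have hmp : ∀ d n, IsProbabilityMeasure (categorical fun k => φ (ν d n) k d) := fun d n =>
    isProbabilityMeasure_categorical (hφ (ν d n) d)
  let ρ : ∀ d, Measure (Fin (N d) → Fin (m + 1)) := fun d =>
    Measure.pi fun n => categorical fun k => φ (ν d n) k d
  have hmp' : ∀ d, IsProbabilityMeasure (ρ d) := fun d => by infer_instance
  have hev : ∀ d n, MeasurePreserving (Function.eval n) (ρ d)
      (categorical fun k => φ (ν d n) k d) := fun d n => measurePreserving_eval _ n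
  -- Items are now word positions, with indicators as counts; the passage to terms comes at the end,
  -- by grouping positions with `sum_wordCount_mul`.
  let c : ∀ d, Fin (N d) → Fin (m + 1) → (Fin (N d) → Fin (m + 1)) → ℝ :=
    fun _ n k z => if z n = k then 1 else 0
  let g : ∀ d, (Fin (N d) → Fin (m + 1)) → ℝ := fun _ _ => 0
  have hc : ∀ d n k, Integrable (c d n k) (ρ d) := fun d n k =>
    (hev d n).integrable_comp_of_integrable
      (integrable_categorical fun j => if j = k then 1 else 0)
  have hg : ∀ d, Integrable (g d) (ρ d) := fun d => integrable_const 0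
  have hci : ∀ d n k, ∫ z, c d n k z ∂(ρ d) = φ (ν d n) k d := by
    intro d n k
    have h := integral_categorical (hφ (ν d n) d) fun j => if j = k then 1 else 0
    rw [← (hev d n).map_eq, integral_map (hev d n).measurable.aemeasurable
        (measurable_of_countable _).aestronglyMeasurable] at h
    simpa using h
  have hae : ∀ d, ∀ᵐ x ∂((dirichlet fun k => β k d).prod (ρ d)),
      ((∀ k, 0 < x.1 k) ∧ ∑ k, x.1 k = 1) ∧ ∀ n, 0 < φ (ν d n) (x.2 n) d := by
    intro d
    refine (Measure.quasiMeasurePreserving_fst.ae (ae_dirichlet_mem (hβ' d))).and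
      (Measure.quasiMeasurePreserving_snd.ae (ae_all_iff.2 fun n =>
        (hev d n).quasiMeasurePreserving.ae ae_categorical_pos))
  have hQ : ∀ d, ∀ᵐ x ∂((dirichlet fun k => β k d).prod (ρ d)),
      0 < dirichletPDF (fun k => β k d) x.1 * ∏ n, φ (ν d n) (x.2 n) d ∧
      Real.log (dirichletPDF (fun k => β k d) x.1 * ∏ n, φ (ν d n) (x.2 n) d) =
      docLog (fun k => β k d) (c d) (g d) 0 0 (fun n k => Real.log (φ (ν d n) k d)) x := by
    intro d
    filter_upwards [hae d] with x hx
    have h1 := (dirichletPDF_pos_iff (hβ' d)).2 hx.1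
    have h2 : 0 < ∏ n, φ (ν d n) (x.2 n) d := Finset.prod_pos fun n _ => hx.2 n
    refine ⟨mul_pos h1 h2, ?_⟩
    rw [Real.log_mul h1.ne' h2.ne', Real.log_prod fun n _ => (hx.2 n).ne']
    simp [docLog, c, g]
  by_cases hs : IsSupported (fun v d => (wordCount ν v d : ℝ)) W φ
  · have hP : ∀ d, ∀ᵐ x ∂((dirichlet fun k => β k d).prod (ρ d)),
        0 < dirichletPDF α x.1 * ∏ n, (x.1 (x.2 n) * W (ν d n) (x.2 n)) ∧
        Real.log (dirichletPDF α x.1 * ∏ n, (x.1 (x.2 n) * W (ν d n) (x.2 n))) =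
        docLog α (c d) (g d) 1 0 (fun n k => Real.log (W (ν d n) k)) x := by
      intro d
      filter_upwards [hae d] with x hx
      have h1 := (dirichletPDF_pos_iff hα).2 hx.1
      have hw : ∀ n, 0 < W (ν d n) (x.2 n) := fun n => hs _ _ d
        (mul_pos (Nat.cast_pos.2 ((wordCount_pos_iff ν _ d).2 ⟨n, rfl⟩)) (hx.2 n))
      have h3 : ∀ n, 0 < x.1 (x.2 n) * W (ν d n) (x.2 n) := fun n => mul_pos (hx.1.1 _) (hw n)
      have h2 := Finset.prod_pos fun n (_ : n ∈ Finset.univ) => h3 n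
      refine ⟨mul_pos h1 h2, ?_⟩
      rw [Real.log_mul h1.ne' h2.ne', Real.log_prod fun n _ => (h3 n).ne']
      simp only [Real.log_mul (hx.1.1 _).ne' (hw _).ne']
      simp [docLog, c, g, Finset.sum_add_distrib]
    obtain ⟨h1, h2⟩ := elbo_meanField_of_pos hα hβ hc hg hQ hP
    refine ⟨h1, h2.trans ?_⟩
    rw [ldaBound_of_isSupported hα hβ hφ hs]
    congr 1
    refine Finset.sum_congr rfl fun d _ => ?_
    simp only [hci, add_zero, sub_zero, mul_assoc, ← Finset.mul_sum]
    rw [sum_wordCount_mul ν d fun v => ∑ k, φ v k d *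
      (meanLog β k d + Real.log (W v k) - Real.log (φ v k d))]
  · have hs' := hs
    unfold IsSupported at hs'
    push Not at hs'
    obtain ⟨v, k, d, h1, h2⟩ := hs'
    have h0 : W v k = 0 := le_antisymm h2 ((hW k).1 v)
    obtain ⟨n, rfl⟩ := (wordCount_pos_iff ν v d).1 (Nat.pos_of_ne_zero fun h => by simp [h] at h1)
    rw [ldaBound_of_not_isSupported hW hs]
    refine elbo_meanField_of_eq_zero (d := d) (i := n) (k := k)
      (P := fun d (x : (Fin (m + 1) → ℝ) × (Fin (N d) → Fin (m + 1))) =>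
        dirichletPDF α x.1 * ∏ n, (x.1 (x.2 n) * W (ν d n) (x.2 n))) hβ hc hg hQ
      (by rw [hci]; exact right_ne_zero_of_mul h1.ne') fun x hx => ?_
    refine mul_eq_zero_of_right _ (Finset.prod_eq_zero (Finset.mem_univ n) ?_)
    have hk : x.2 n = k := by
      by_contra h
      exact hx (by simp [c, h])
    rw [hk, h0, mul_zero]

end LDAModel

/-! ### Equality of the two VI procedures -/

theorem IsVIRun.of_eq_add_const {V D m : ℕ}
    {L L' : (Fin V → Fin (m + 1) → ℝ) → (Fin (m + 1) → Fin D → ℝ) →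
      (Fin V → Fin (m + 1) → Fin D → ℝ) → EReal} (C : ℝ)
    (h : ∀ W β φ, IsTopicMatrix W → IsDirichletParam β → IsAssignment φ →
      L' W β φ = L W β φ + (C : EReal))
    {W : ℕ → Fin V → Fin (m + 1) → ℝ} {β : ℕ → Fin (m + 1) → Fin D → ℝ}
    {φ : ℕ → Fin V → Fin (m + 1) → Fin D → ℝ} (hr : IsVIRun L W β φ) : IsVIRun L' W β φ := by
  obtain ⟨h1, h2⟩ := hr
  refine ⟨h1, fun n => ⟨isMaxOn_iff.2 fun φ' hφ' => ?_, isMaxOn_iff.2 fun θ hθ => ?_⟩⟩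
  · rw [h _ _ _ (h1 n).1 (h1 n).2.1 hφ', h _ _ _ (h1 n).1 (h1 n).2.1 (h1 n).2.2]
    exact add_le_add_left (isMaxOn_iff.1 (h2 n).1 φ' hφ') _
  · rw [h _ _ _ hθ.1 hθ.2 (h1 n).2.2,
      h _ _ _ (h1 (n + 1)).1 (h1 (n + 1)).2.1 (h1 n).2.2]
    exact add_le_add_left (isMaxOn_iff.1 (h2 n).2 θ hθ) _

theorem isVIRun_dpElbo_iff {V D m : ℕ} {α : Fin (m + 1) → ℝ} (hα : ∀ k, 0 < α k)
    (X : Fin V → Fin D → ℕ) {W : ℕ → Fin V → Fin (m + 1) → ℝ} {β : ℕ → Fin (m + 1) → Fin D → ℝ}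
    {φ : ℕ → Fin V → Fin (m + 1) → Fin D → ℝ} :
    IsVIRun (dpElbo X α) W β φ ↔ IsVIRun (ldaBound X α) W β φ := by
  -- The shift is a real number, so it can be undone in `EReal` even where the bounds are `⊥`.
  refine ⟨IsVIRun.of_eq_add_const (-(-(D : ℝ) - ∑ v, ∑ d, Real.log ((X v d).factorial : ℝ)))
    fun W β φ hW hβ hφ => ?_, IsVIRun.of_eq_add_const
      (-(D : ℝ) - ∑ v, ∑ d, Real.log ((X v d).factorial : ℝ))
      fun W β φ hW hβ hφ => (dpElbo_eq hα X hW hβ hφ).2⟩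
  rw [(dpElbo_eq hα X hW hβ hφ).2, add_assoc, ← EReal.coe_add, add_neg_cancel, EReal.coe_zero,
    add_zero]

theorem isVIRun_ldaElbo_iff {V D m : ℕ} {α : Fin (m + 1) → ℝ} (hα : ∀ k, 0 < α k)
    {N : Fin D → ℕ} (ν : (d : Fin D) → Fin (N d) → Fin V)
    {W : ℕ → Fin V → Fin (m + 1) → ℝ} {β : ℕ → Fin (m + 1) → Fin D → ℝ}
    {φ : ℕ → Fin V → Fin (m + 1) → Fin D → ℝ} :
    IsVIRun (ldaElbo ν α) W β φ ↔ IsVIRun (ldaBound (wordCount ν) α) W β φ :=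
  ⟨IsVIRun.of_eq_add_const 0 fun W β φ hW hβ hφ => by
      rw [(ldaElbo_eq hα ν hW hβ hφ).2, EReal.coe_zero, add_zero],
    IsVIRun.of_eq_add_const 0 fun W β φ hW hβ hφ => by
      rw [(ldaElbo_eq hα ν hW hβ hφ).2, EReal.coe_zero, add_zero]⟩

/-! ### The LDA updates as maximizers -/

section Maximizers

/-- **Gibbs' inequality** for finite probability vectors. -/
theorem sum_mul_log_le_of_mem_stdSimplex {ι : Type*} [Fintype ι] {p q : ι → ℝ}
    (hp : p ∈ stdSimplex ℝ ι) (hq : q ∈ stdSimplex ℝ ι) (h : ∀ i, 0 < p i → 0 < q i) :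
    ∑ i, p i * Real.log (q i) ≤ ∑ i, p i * Real.log (p i) := by
  have hterm : ∀ i, p i * Real.log (q i) - p i * Real.log (p i) ≤ q i - p i := by
    intro i
    rcases (hp.1 i).eq_or_lt with h0 | h0
    · simp [← h0, hq.1 i]
    · have h1 := h i h0
      have h2 := Real.log_le_sub_one_of_pos (div_pos h1 h0)
      rw [Real.log_div h1.ne' h0.ne'] at h2
      have h3 := mul_le_mul_of_nonneg_left h2 h0.le
      rwa [mul_sub, mul_sub, mul_div_cancel₀ _ h0.ne', mul_one] at h3
  have hsum := Finset.sum_le_sum fun i (_ : i ∈ Finset.univ) => hterm i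
  rw [Finset.sum_sub_distrib, Finset.sum_sub_distrib, hp.2, hq.2] at hsum
  linarith

theorem PropTo.pos_of_pos {ι : Type*} [Fintype ι] {u c : ι → ℝ} (h : PropTo u c) {i : ι}
    (hi : 0 < c i) : 0 < u i :=
  (h.1.1 i).lt_of_ne' fun h0 => by
    have := h.2 i
    rw [h0, zero_mul] at this
    exact hi.ne this

variable {V D m : ℕ} {α : Fin (m + 1) → ℝ} {W : Fin V → Fin (m + 1) → ℝ}
  {β : Fin (m + 1) → Fin D → ℝ} {φ φ' : Fin V → Fin (m + 1) → Fin D → ℝ}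
  {X : Fin V → Fin D → ℝ}

theorem hTilde_pos (β : Fin (m + 1) → Fin D → ℝ) (k : Fin (m + 1)) (d : Fin D) :
    0 < hTilde β k d := Real.exp_pos _

theorem recon_pos (hW : IsTopicMatrix W) {v : Fin V} (d : Fin D) (h : ∃ k, 0 < W v k) :
    0 < recon W β v d := by
  obtain ⟨k, hk⟩ := h
  exact Finset.sum_pos' (fun j _ => mul_nonneg ((hW j).1 v) (hTilde_pos β j d).le)
    ⟨k, Finset.mem_univ k, mul_pos hk (hTilde_pos β k d)⟩

/-- Since `φ_vd` sums to one, it charges some topic, and support gives that topic positive weight at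
`v`. -/
theorem exists_pos_of_isSupported (hφ : IsAssignment φ) (hs : IsSupported X W φ) {v : Fin V}
    {d : Fin D} (hX : 0 < X v d) : ∃ k, 0 < W v k := by
  by_contra! hn
  have h0 : ∀ k, φ v k d = 0 := fun k => by
    by_contra h
    exact (hs v k d (mul_pos hX (((hφ v d).1 k).lt_of_ne' h))).not_ge (hn k)
  have := (hφ v d).2
  simp [h0] at this

theorem isSupported_of_propTo (hX : ∀ v d, 0 ≤ X v d) (hW : IsTopicMatrix W)
    (hφ : ∀ v d, PropTo (fun k => φ v k d) fun k => W v k * hTilde β k d)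
    (hs : ∀ v d, 0 < X v d → ∃ k, 0 < W v k) : IsSupported X W φ := by
  intro v k d h
  have hXp : 0 < X v d := (hX v d).lt_of_ne' (left_ne_zero_of_mul h.ne')
  have hφp : 0 < φ v k d := ((hφ v d).1.1 k).lt_of_ne' (right_ne_zero_of_mul h.ne')
  have h1 : φ v k d * recon W β v d = W v k * hTilde β k d := (hφ v d).2 k
  exact pos_of_mul_pos_left (h1 ▸ mul_pos hφp (recon_pos hW d (hs v d hXp))) (hTilde_pos β k d).le

/-- For `x_vd > 0`, the normalization of `w h̃` makes the inner sum equal `log (W H̃)_vd` minus the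
divergence of the competitor from `φ_vd`; the update attains divergence zero. Pairs with `x_vd = 0`
do not contribute. -/
theorem finiteBound_le_of_propTo_assignment (hX : ∀ v d, 0 ≤ X v d) (hW : IsTopicMatrix W)
    (hφ : ∀ v d, PropTo (fun k => φ v k d) fun k => W v k * hTilde β k d)
    (hφ' : IsAssignment φ') (hs' : IsSupported X W φ') :
    finiteBound X α W β φ' ≤ finiteBound X α W β φ := by
  refine Finset.sum_le_sum fun d _ => add_le_add le_rfl (Finset.sum_le_sum fun v _ => ?_)
  simp only [mul_assoc, ← Finset.mul_sum]
  rcases (hX v d).eq_or_lt with h0 | h0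
  · simp [← h0]
  refine mul_le_mul_of_nonneg_left ?_ h0.le
  have hC : 0 < recon W β v d := recon_pos hW d (exists_pos_of_isSupported hφ' hs' h0)
  have heq : ∀ k, φ v k d * recon W β v d = W v k * hTilde β k d := (hφ v d).2
  have hlog : ∀ k, 0 < W v k →
      meanLog β k d + Real.log (W v k) = Real.log (φ v k d) + Real.log (recon W β v d) := by
    intro k hk
    have hp : 0 < φ v k d := (hφ v d).pos_of_pos (mul_pos hk (hTilde_pos β k d))
    rw [← Real.log_mul hp.ne' hC.ne', heq, Real.log_mul hk.ne' (hTilde_pos β k d).ne', hTilde,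
      Real.log_exp, add_comm]
  have hpos' : ∀ k, 0 < φ' v k d → 0 < W v k := fun k hk => hs' v k d (mul_pos h0 hk)
  have hpos : ∀ k, 0 < φ v k d → 0 < W v k := fun k hk =>
    pos_of_mul_pos_left (heq k ▸ mul_pos hk hC) (hTilde_pos β k d).le
  have hl : ∀ k, φ' v k d * (meanLog β k d + Real.log (W v k) - Real.log (φ' v k d)) =
      φ' v k d * Real.log (φ v k d) - φ' v k d * Real.log (φ' v k d) +
        φ' v k d * Real.log (recon W β v d) := by
    intro k
    rcases ((hφ' v d).1 k).eq_or_lt with h1 | h1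
    · simp only at h1; simp [← h1]
    · rw [hlog k (hpos' k h1)]; ring
  have hr : ∀ k, φ v k d * (meanLog β k d + Real.log (W v k) - Real.log (φ v k d)) =
        φ v k d * Real.log (recon W β v d) := by
    intro k
    rcases ((hφ v d).1.1 k).eq_or_lt with h1 | h1
    · simp only at h1; simp [← h1]
    · rw [hlog k (hpos k h1)]; ring
  have hg := sum_mul_log_le_of_mem_stdSimplex (hφ' v d) (hφ v d).1 fun k hk =>
    (hφ v d).pos_of_pos (mul_pos (hpos' k hk) (hTilde_pos β k d))
  have e1 := (hφ' v d).2
  have e2 := (hφ v d).1.2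
  simp only [hl, hr, Finset.sum_add_distrib, Finset.sum_sub_distrib, ← Finset.sum_mul] at *
  rw [e1, e2]
  linarith

theorem dirichletGain_nonpos (hα : ∀ k, 0 < α k) (hβ : IsDirichletParam β) (d : Fin D) :
    dirichletGain α β d ≤ 0 :=
  sub_nonpos.2 (integral_log_dirichletPDF_le hα fun k => hβ k d)

/-- Conjugacy: expected log proportions weighted by counts `s` shift the prior parameter to `α + s`,
up to a term free of `β`. -/
theorem dirichletGain_add (hα : ∀ k, 0 < α k) (hβ : IsDirichletParam β) {s : Fin (m + 1) → ℝ}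
    (hs : ∀ k, 0 ≤ s k) (d : Fin D) :
    dirichletGain α β d + ∑ k, s k * meanLog β k d =
      dirichletGain (fun k => α k + s k) β d +
        ((Real.log (Real.Gamma (∑ k, α k)) - ∑ k, Real.log (Real.Gamma (α k))) -
        (Real.log (Real.Gamma (∑ k, (α k + s k))) -
          ∑ k, Real.log (Real.Gamma (α k + s k)))) := by
  rw [dirichletGain_eq hα hβ, dirichletGain_eq (fun k => add_pos_of_pos_of_nonneg (hα k) (hs k)) hβ]
  simp only [sub_mul, add_mul, Finset.sum_add_distrib, Finset.sum_sub_distrib]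
  ring

/-- For fixed `φ` the variables `β` and `W` separate, so the joint maximization reduces to two
independent ones. -/
theorem finiteBound_eq_split (X : Fin V → Fin D → ℝ) (α : Fin (m + 1) → ℝ)
    (W : Fin V → Fin (m + 1) → ℝ) (β : Fin (m + 1) → Fin D → ℝ)
    (φ : Fin V → Fin (m + 1) → Fin D → ℝ) :
    finiteBound X α W β φ =
      ∑ d, (dirichletGain α β d + ∑ k, (∑ v, X v d * φ v k d) * meanLog β k d) +
      ∑ k, ∑ v, (∑ d, X v d * φ v k d) * Real.log (W v k) -
      ∑ d, ∑ v, ∑ k, X v d * φ v k d * Real.log (φ v k d) := by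
  have h1 : ∑ k, ∑ v, (∑ d, X v d * φ v k d) * Real.log (W v k) =
      ∑ d, ∑ v, ∑ k, X v d * φ v k d * Real.log (W v k) := by
    simp only [Finset.sum_mul]
    refine Finset.sum_comm.trans (Eq.trans ?_ Finset.sum_comm)
    exact Finset.sum_congr rfl fun v _ => Finset.sum_comm
  have h2 : ∀ d, ∑ k, (∑ v, X v d * φ v k d) * meanLog β k d =
      ∑ v, ∑ k, X v d * φ v k d * meanLog β k d := by
    intro d
    simp only [Finset.sum_mul]
    exact Finset.sum_comm
  rw [h1]
  simp only [h2, finiteBound, mul_sub, mul_add, Finset.sum_add_distrib, Finset.sum_sub_distrib]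
  ring

theorem finiteBound_le_of_propTo_topics (hα : ∀ k, 0 < α k) (hX : ∀ v d, 0 ≤ X v d)
    (hφ : IsAssignment φ) {W' : Fin V → Fin (m + 1) → ℝ} {β' : Fin (m + 1) → Fin D → ℝ}
    (hW : ∀ k, PropTo (fun v => W v k) fun v => ∑ d, X v d * φ v k d)
    (hβ : ∀ k d, β k d = α k + ∑ v, X v d * φ v k d) (hW' : IsTopicMatrix W')
    (hβ' : IsDirichletParam β') (hs : IsSupported X W' φ) :
    finiteBound X α W' β' φ ≤ finiteBound X α W β φ := by
  have hnn : ∀ v k d, 0 ≤ X v d * φ v k d := fun v k d => mul_nonneg (hX v d) ((hφ v d).1 k)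
  have hsn : ∀ d k, 0 ≤ ∑ v, X v d * φ v k d := fun d k => Finset.sum_nonneg fun v _ => hnn v k d
  have hβp : IsDirichletParam β := fun k d => by
    rw [hβ]; exact add_pos_of_pos_of_nonneg (hα k) (hsn d k)
  rw [finiteBound_eq_split, finiteBound_eq_split]
  refine sub_le_sub_right (add_le_add (Finset.sum_le_sum fun d _ => ?_)
    (Finset.sum_le_sum fun k _ => ?_)) _
  · rw [dirichletGain_add hα hβ' (hsn d), dirichletGain_add hα hβp (hsn d)]
    refine add_le_add ?_ le_rfl
    have h0 : dirichletGain (fun k => α k + ∑ v, X v d * φ v k d) β d = 0 := by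
      simp only [← hβ]; exact sub_self _
    rw [h0]
    exact dirichletGain_nonpos (fun k => add_pos_of_pos_of_nonneg (hα k) (hsn d k)) hβ' d
  · have heq : ∀ v, W v k * ∑ v', ∑ d, X v' d * φ v' k d = ∑ d, X v d * φ v k d := (hW k).2
    have hCn : 0 ≤ ∑ v', ∑ d, X v' d * φ v' k d :=
      Finset.sum_nonneg fun v _ => Finset.sum_nonneg fun d _ => hnn v k d
    generalize ∑ v', ∑ d, X v' d * φ v' k d = C at heq hCn
    -- If the topic receives no words, its column is arbitrary and both sides are zero.
    rcases hCn.eq_or_lt with h0 | h0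
    · simp [← heq, ← h0]
    simp only [← heq, mul_right_comm _ C, ← Finset.sum_mul]
    refine mul_le_mul_of_nonneg_right (sum_mul_log_le_of_mem_stdSimplex (hW k).1 (hW' k)
      fun v hv => ?_) hCn
    have h1 : 0 < ∑ d, X v d * φ v k d := heq v ▸ mul_pos hv h0
    obtain ⟨d, -, hd⟩ := Finset.exists_lt_of_sum_lt (f := fun _ => (0 : ℝ)) (by simpa using h1)
    exact hs v k d hd

theorem IsLDARun.isVIRun {α : Fin (m + 1) → ℝ} (hα : ∀ k, 0 < α k) {X : Fin V → Fin D → ℕ}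
    {W : ℕ → Fin V → Fin (m + 1) → ℝ} {β : ℕ → Fin (m + 1) → Fin D → ℝ}
    {φ : ℕ → Fin V → Fin (m + 1) → Fin D → ℝ}
    (h : IsLDARun (fun v d => (X v d : ℝ)) α W β φ) : IsVIRun (ldaBound X α) W β φ := by
  obtain ⟨hW0, hβ0, hstep⟩ := h
  have hX : ∀ v d, (0 : ℝ) ≤ (X v d : ℝ) := fun v d => Nat.cast_nonneg _
  have hφ : ∀ n, IsAssignment (φ n) := fun n v d => ((hstep n).1 v d).1
  have hW : ∀ n, IsTopicMatrix (W n) := fun n => by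
    cases n with
    | zero => exact hW0
    | succ n => exact fun k => ((hstep n).2.1 k).1
  have hβ : ∀ n, IsDirichletParam (β n) := fun n => by
    cases n with
    | zero => exact hβ0
    | succ n =>
      intro k d
      rw [(hstep n).2.2 k d]
      exact add_pos_of_pos_of_nonneg (hα k)
        (Finset.sum_nonneg fun v _ => mul_nonneg (hX v d) ((hφ n v d).1 k))
  refine ⟨fun n => ⟨hW n, hβ n, hφ n⟩, fun n => ⟨isMaxOn_iff.2 fun φ' hφ' => ?_,
    isMaxOn_iff.2 fun θ hθ => ?_⟩⟩
  -- An unsupported competitor has value `⊥`. The update itself is unsupported only if every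
  -- competitor is, since a supported one makes all normalizers with `x_vd > 0` positive.
  · by_cases hs : IsSupported (fun v d => (X v d : ℝ)) (W n) φ'
    · rw [ldaBound_of_isSupported hα (hβ n) hφ' hs, ldaBound_of_isSupported hα (hβ n) (hφ n)
        (isSupported_of_propTo hX (hW n) (hstep n).1 fun v d => exists_pos_of_isSupported hφ' hs),
        EReal.coe_le_coe_iff]
      exact finiteBound_le_of_propTo_assignment hX (hW n) (hstep n).1 hφ' hs
    · rw [ldaBound_of_not_isSupported (hW n) hs]
      exact bot_le
  · by_cases hs : IsSupported (fun v d => (X v d : ℝ)) θ.1 (φ n)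
    · have hs' : IsSupported (fun v d => (X v d : ℝ)) (W (n + 1)) (φ n) := fun v k d hv =>
        ((hstep n).2.1 k).pos_of_pos (Finset.sum_pos' (fun d' _ => mul_nonneg (hX v d')
          ((hφ n v d').1 k)) ⟨d, Finset.mem_univ d, hv⟩)
      rw [ldaBound_of_isSupported hα hθ.2 (hφ n) hs,
        ldaBound_of_isSupported hα (hβ (n + 1)) (hφ n) hs', EReal.coe_le_coe_iff]
      exact finiteBound_le_of_propTo_topics hα hX (hφ n) (hstep n).2.1 (hstep n).2.2 hθ.1 hθ.2 hs
    · rw [ldaBound_of_not_isSupported hθ.1 hs]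
      exact bot_le

end Maximizers

/-! ### Elimination of `φ`: the multiplicative updates -/

section Algorithms

variable {V D m : ℕ} {α : Fin (m + 1) → ℝ} {X : Fin V → Fin D → ℝ}

/-- The weights of the multiplicative topic update. -/
noncomputable def topicWeight (X : Fin V → Fin D → ℝ) (W : Fin V → Fin (m + 1) → ℝ)
    (β : Fin (m + 1) → Fin D → ℝ) (k : Fin (m + 1)) (v : Fin V) : ℝ :=
  W v k * ∑ d, X v d * (hTilde β k d / recon W β v d)

/-- Where the weights of `φ_vd` all vanish, `φ_vd` is arbitrary, but there `x_vd = 0`; the product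
is determined in every case. -/
theorem mul_assignment_eq (hX : ∀ v d, 0 ≤ X v d) {W : Fin V → Fin (m + 1) → ℝ}
    {β : Fin (m + 1) → Fin D → ℝ} {φ : Fin V → Fin (m + 1) → Fin D → ℝ} (hW : IsTopicMatrix W)
    (hs : ∀ v d, 0 < X v d → ∃ k, 0 < W v k)
    (hφ : ∀ v d, PropTo (fun k => φ v k d) fun k => W v k * hTilde β k d)
    (v : Fin V) (k : Fin (m + 1)) (d : Fin D) :
    X v d * φ v k d = X v d * (W v k * hTilde β k d / recon W β v d) := by
  rcases (hX v d).eq_or_lt with h0 | h0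
  · simp [← h0]
  · have h : φ v k d * recon W β v d = W v k * hTilde β k d := (hφ v d).2 k
    rw [eq_div_of_mul_eq (recon_pos hW d (hs v d h0)).ne' h]

theorem sum_mul_assignment_eq (hX : ∀ v d, 0 ≤ X v d) {W : Fin V → Fin (m + 1) → ℝ}
    {β : Fin (m + 1) → Fin D → ℝ} {φ : Fin V → Fin (m + 1) → Fin D → ℝ} (hW : IsTopicMatrix W)
    (hs : ∀ v d, 0 < X v d → ∃ k, 0 < W v k)
    (hφ : ∀ v d, PropTo (fun k => φ v k d) fun k => W v k * hTilde β k d) :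
    (∀ k v, ∑ d, X v d * φ v k d = topicWeight X W β k v) ∧
      ∀ k d, ∑ v, X v d * φ v k d =
        hTilde β k d * ∑ v, X v d * (W v k / recon W β v d) := by
  constructor
  · intro k v
    rw [topicWeight, Finset.mul_sum]
    refine Finset.sum_congr rfl fun d _ => ?_
    rw [mul_assignment_eq hX hW hs hφ]
    ring
  · intro k d
    rw [Finset.mul_sum]
    refine Finset.sum_congr rfl fun v _ => ?_
    rw [mul_assignment_eq hX hW hs hφ]
    ring

/-- Makes the hypothesis on `W 0` an invariant: a multiplicative update keeps a positive entry
positive if its term occurs in some document. -/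
theorem exists_pos_of_propTo_topicWeight (hX : ∀ v d, 0 ≤ X v d)
    {W W' : Fin V → Fin (m + 1) → ℝ} {β : Fin (m + 1) → Fin D → ℝ} (hW : IsTopicMatrix W)
    (hs : ∀ v d, 0 < X v d → ∃ k, 0 < W v k)
    (hW' : ∀ k, PropTo (fun v => W' v k) (topicWeight X W β k)) :
    ∀ v d, 0 < X v d → ∃ k, 0 < W' v k := by
  intro v d hv
  obtain ⟨k, hk⟩ := hs v d hv
  refine ⟨k, (hW' k).pos_of_pos (mul_pos hk ?_)⟩
  have hr : ∀ d, 0 < recon W β v d := fun d => recon_pos hW d ⟨k, hk⟩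
  exact Finset.sum_pos' (fun d' _ => mul_nonneg (hX v d')
    (div_pos (hTilde_pos β k d') (hr d')).le)
    ⟨d, Finset.mem_univ d, mul_pos hv (div_pos (hTilde_pos β k d) (hr d))⟩

theorem exists_assignment_propTo {W : Fin V → Fin (m + 1) → ℝ} (hW : IsTopicMatrix W)
    (β : Fin (m + 1) → Fin D → ℝ) : ∃ φ : Fin V → Fin (m + 1) → Fin D → ℝ,
      ∀ v d, PropTo (fun k => φ v k d) fun k => W v k * hTilde β k d := by
  classical
  have hnn : ∀ v k d, 0 ≤ W v k * hTilde β k d := fun v k d =>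
    mul_nonneg ((hW k).1 v) (hTilde_pos β k d).le
  have : ∀ v d, ∃ u : Fin (m + 1) → ℝ, PropTo u fun k => W v k * hTilde β k d := by
    intro v d
    have hC : 0 ≤ recon W β v d := Finset.sum_nonneg fun k _ => hnn v k d
    rcases hC.eq_or_lt with h0 | h0
    · have hz := (Finset.sum_eq_zero_iff_of_nonneg fun k _ => hnn v k d).1 h0.symm
      -- All weights vanish, so any point of the simplex will do.
      refine ⟨Pi.single 0 1, single_mem_stdSimplex ℝ 0, fun k => ?_⟩
      change _ * recon W β v d = W v k * hTilde β k d
      rw [← h0, mul_zero, hz k (Finset.mem_univ k)]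
    · refine ⟨fun k => W v k * hTilde β k d / recon W β v d,
        ⟨fun k => div_nonneg (hnn v k d) h0.le, ?_⟩, fun k => div_mul_cancel₀ _ h0.ne'⟩
      rw [← Finset.sum_div]
      exact div_self h0.ne'
  choose u hu using this
  exact ⟨fun v k d => u v d k, hu⟩

theorem isDPRun_iff_exists_isLDARun (hX : ∀ v d, 0 ≤ X v d)
    {W : ℕ → Fin V → Fin (m + 1) → ℝ} {β : ℕ → Fin (m + 1) → Fin D → ℝ}
    (hs : ∀ v d, 0 < X v d → ∃ k, 0 < W 0 v k) :
    IsDPRun X α W β ↔ ∃ φ, IsLDARun X α W β φ := by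
  constructor
  · rintro ⟨hW0, hβ0, hstep⟩
    have hW : ∀ n, IsTopicMatrix (W n) := fun n => by
      cases n with
      | zero => exact hW0
      | succ n => exact fun k => ((hstep n).1 k).1
    have hsn : ∀ n, ∀ v d, 0 < X v d → ∃ k, 0 < W n v k := fun n => by
      induction n with
      | zero => exact hs
      | succ n ih => exact exists_pos_of_propTo_topicWeight hX (hW n) ih (hstep n).1
    choose φ hφ using fun n => exists_assignment_propTo (hW n) (β n)
    refine ⟨φ, hW0, hβ0, fun n => ⟨hφ n, fun k => ?_, fun k d => ?_⟩⟩
    · simp only [(sum_mul_assignment_eq hX (hW n) (hsn n) (hφ n)).1]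
      exact (hstep n).1 k
    · rw [(sum_mul_assignment_eq hX (hW n) (hsn n) (hφ n)).2]
      exact (hstep n).2 k d
  · rintro ⟨φ, hW0, hβ0, hstep⟩
    have hW : ∀ n, IsTopicMatrix (W n) := fun n => by
      cases n with
      | zero => exact hW0
      | succ n => exact fun k => ((hstep n).2.1 k).1
    -- The multiplicative form of a step needs positivity at `n`, and positivity at `n + 1` needs
    -- this form; stating it conditionally lets the induction for `hsn` proceed.
    have hprop : ∀ n, (∀ v d, 0 < X v d → ∃ k, 0 < W n v k) →
        ∀ k, PropTo (fun v => W (n + 1) v k) (topicWeight X (W n) (β n) k) := by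
      intro n hn k
      have h := (hstep n).2.1 k
      simp only [(sum_mul_assignment_eq hX (hW n) hn (hstep n).1).1] at h
      exact h
    have hsn : ∀ n, ∀ v d, 0 < X v d → ∃ k, 0 < W n v k := fun n => by
      induction n with
      | zero => exact hs
      | succ n ih => exact exists_pos_of_propTo_topicWeight hX (hW n) ih (hprop n ih)
    refine ⟨hW0, hβ0, fun n => ⟨hprop n (hsn n), fun k d => ?_⟩⟩
    rw [(hstep n).2.2 k d, (sum_mul_assignment_eq hX (hW n) (hsn n) (hstep n).1).2]

end Algorithms

end DirichletPoisson

theorem mainTheorem1 (V D m : ℕ) (α : Fin (m + 1) → ℝ) (hα : ∀ k, 0 < α k) :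
    -- the lower bound of the Dirichlet–Poisson model is the explicit LDA bound up to a constant
    (∀ (X : Fin V → Fin D → ℕ) (W : Fin V → Fin (m + 1) → ℝ) (β : Fin (m + 1) → Fin D → ℝ)
      (φ : Fin V → Fin (m + 1) → Fin D → ℝ),
      DirichletPoisson.IsTopicMatrix W → DirichletPoisson.IsDirichletParam β →
      DirichletPoisson.IsAssignment φ →
        DirichletPoisson.ElboWellDefined (DirichletPoisson.dpVar X β φ)
          (DirichletPoisson.dpJoint X α W) (DirichletPoisson.dpVarDens X β φ) ∧
        (∀ k d, MeasureTheory.Integrable (fun h : Fin (m + 1) → ℝ => Real.log (h k))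
          (DirichletPoisson.dirichlet fun k' => β k' d)) ∧
        DirichletPoisson.dpElbo X α W β φ =
          DirichletPoisson.ldaBound X α W β φ +
            ((-(D : ℝ) - ∑ v, ∑ d, Real.log ((X v d).factorial : ℝ) : ℝ) : EReal)) ∧
    -- the explicit LDA bound is the variational lower bound of LDA
    (∀ (N : Fin D → ℕ) (ν : (d : Fin D) → Fin (N d) → Fin V) (W : Fin V → Fin (m + 1) → ℝ)
      (β : Fin (m + 1) → Fin D → ℝ) (φ : Fin V → Fin (m + 1) → Fin D → ℝ),
      DirichletPoisson.IsTopicMatrix W → DirichletPoisson.IsDirichletParam β →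
      DirichletPoisson.IsAssignment φ →
        DirichletPoisson.ElboWellDefined (DirichletPoisson.ldaVar ν β φ)
          (DirichletPoisson.ldaJoint ν α W) (DirichletPoisson.ldaVarDens ν β φ) ∧
        DirichletPoisson.ldaElbo ν α W β φ =
          DirichletPoisson.ldaBound (DirichletPoisson.wordCount ν) α W β φ) ∧
    -- the VI procedures of the two models are the same
    (∀ (N : Fin D → ℕ) (ν : (d : Fin D) → Fin (N d) → Fin V)
      (W : ℕ → Fin V → Fin (m + 1) → ℝ) (β : ℕ → Fin (m + 1) → Fin D → ℝ)
      (φ : ℕ → Fin V → Fin (m + 1) → Fin D → ℝ),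
      DirichletPoisson.IsVIRun
          (DirichletPoisson.dpElbo (DirichletPoisson.wordCount ν) α) W β φ ↔
        DirichletPoisson.IsVIRun (DirichletPoisson.ldaElbo ν α) W β φ) ∧
    -- the explicit updates carry out this procedure
    (∀ (X : Fin V → Fin D → ℕ)
      (W : ℕ → Fin V → Fin (m + 1) → ℝ) (β : ℕ → Fin (m + 1) → Fin D → ℝ)
      (φ : ℕ → Fin V → Fin (m + 1) → Fin D → ℝ),
      DirichletPoisson.IsLDARun (fun v d => (X v d : ℝ)) α W β φ →
        DirichletPoisson.IsVIRun (DirichletPoisson.dpElbo X α) W β φ) ∧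
    -- the two algorithms have the same iterates
    (∀ X : Fin V → Fin D → ℝ, (∀ v d, 0 ≤ X v d) →
      ∀ (W : ℕ → Fin V → Fin (m + 1) → ℝ) (β : ℕ → Fin (m + 1) → Fin D → ℝ),
        (∀ v d, 0 < X v d → ∃ k, 0 < W 0 v k) →
          (DirichletPoisson.IsDPRun X α W β ↔
            ∃ φ : ℕ → Fin V → Fin (m + 1) → Fin D → ℝ,
              DirichletPoisson.IsLDARun X α W β φ)) := by 
  refine ⟨fun X W β φ hW hβ hφ => ?_, fun N ν W β φ hW hβ hφ => ?_, fun N ν W β φ => ?_,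
    fun X W β φ h => ?_, fun X hX W β hs => ?_⟩
  · have h := DirichletPoisson.dpElbo_eq hα X hW hβ hφ
    exact ⟨h.1, fun k d => DirichletPoisson.integrable_log_dirichlet (fun k' => hβ k' d) k, h.2⟩
  · exact DirichletPoisson.ldaElbo_eq hα ν hW hβ hφ
  · rw [DirichletPoisson.isVIRun_dpElbo_iff hα, DirichletPoisson.isVIRun_ldaElbo_iff hα]
  · exact (DirichletPoisson.isVIRun_dpElbo_iff hα X).2 (h.isVIRun hα)
  · exact DirichletPoisson.isDPRun_iff_exists_isLDARun hX hs
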